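/- Conventions. A represented space is a set $X$ with a partial surjection $\delta_X:\subseteq\mathbb N^{\mathbb N}\to X$; if $\delta_X(p)=x$, then $p$ is a name of $x$. A map between represented spaces is computable (continuous) if some computable (continuous) partial function on $\mathbb N^{\mathbb N}$ sends every name of every point to a name of the image of that point. $\mathcal C(\mathbf X,\mathbf Y)$ is the represented space of continuous maps $\mathbf X\to\mathbf Y$, a name of a map being a code (Kleene associate) of a realizer; products and finite sequences $\mathbf X^*$ carry their usual representations. $\mathbb S=\{\top,\bot\}$ is Sierpiński space, where $0^\omega$ is the only name of $\bot$ and all other sequences are names of $\top$. For $k\ge 1$ let $\mathbf k=\{0,\dots,k-1\}$ and let $\mathbf k_\bot=\mathbf k\cup\{\bot\}$, where $0^\omega$ is the only name of $\bot$ and the sequences $0^m1^{l+1}0^\omega$ are the names of $l\in\mathbf k$. A computable metric space is a metric space $(X,d)$ with a dense sequence whose mutual distances form a computable double sequence of reals, represented by sequences of its members that converge with speed $2^{-n}$; $\mathbb R$ is represented in the same way by rational sequences, and $\mathbb R_+=\{\varepsilon\in\mathbb R:\varepsilon>0\}$ is a subspace of it. A represented space $\mathbf X$ is computably compact if the map $\mathcal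 C(\mathbf X,\mathbb S)\to\mathbb S$ that sends the constant map $\top$ to $\top$ and every other map to $\bot$ is computable. Let $\mathbf X$ be a computable metric space with metric $d$, and let $k\ge1$. For a learner $L\in\mathcal C((\mathbf X\times\mathbf k)^*,\mathcal C(\mathbf X,\mathbf k_\bot))$, $N\in\mathbb N$ and $\varepsilon>0$, finite training data $D\in(\mathbf X\times\mathbf k)^*$ is called - sparse at $x\in\mathbf X$ if there are $A,B\in(\mathbf X\times\mathbf k)^*$, each of length at most $N$ and with all points at distance $>\varepsilon$ from $x$, such that, for the concatenations $DA$ and $DB$, $\bot\neq L(DA)(x)\neq L(DB)(x)\neq\bot$; - dense at $x\in\mathbf X$ if for all $A,B\in(\mathbf X\times\mathbf k)^*$, each of length at most $N$ and with all points at distance $\geq\varepsilon$ from $x$, we have $L(DA)(x)=L(DB)(x)\neq\bot$. Theorem. Let $\mathbf X$ be a computably compact computable metric space and $k\ge1$. There is a computable map $$\operatorname{SprsOrDns}:\mathcal C((\mathbf X\times\mathbf k)^*,\mathcal C(\mathbf X,\mathbf k_\bot))\times\mathbb N\times\mathbb R_+\times(\mathbf X\times\mathbf k)^*\times\mathbf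 X\to\mathbf 2_\bot$$ such that, for all $L,N,\varepsilon,D,x$, $\operatorname{SprsOrDns}(L,N,\varepsilon,D,x)=0$ if and only if $D$ is sparse at $x$, and $\operatorname{SprsOrDns}(L,N,\varepsilon,D,x)=1$ if and only if $D$ is dense at $x$. -/

import Mathlib

namespace CompAnalysis

/-! ## Computability on Baire space -/

/-- The prefix of length `m` of the sequence `p`. -/
def pre (p : ℕ → ℕ) (m : ℕ) : List ℕ := (List.range m).map p

/-- The query "output digit `n`, having read the prefix of length `m` of `p`", as a number. -/
def query (p : ℕ → ℕ) (n m : ℕ) : ℕ := Encodable.encode (n, pre p m)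

/-- The partial function `ℕ^ℕ → ℕ^ℕ` with Kleene associate `q`. The digit `n` of the value at `p`
is computed by reading longer and longer prefixes of `p`; the answer `0` of `q` means "read on",
and the answer `v + 1` means "the digit is `v`". The value at `p` is defined iff all its digits
are. Every continuous partial function on Baire space has an extension of this form, and the
computable ones (in the sense of oracle, or Type-2, machines) are those for which the associate
can be chosen computable. -/
noncomputable def assocFun (q : ℕ → ℕ) : (ℕ → ℕ) →. (ℕ → ℕ) := fun p =>
  open Classical in
  ⟨∀ n, ∃ m, q (query p n m) ≠ 0, fun h n => q (query p n (Nat.find (h n))) - 1⟩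

/-! ## Represented spaces -/

/-- A representation of the set `X`: a partial surjection `δ` from `ℕ^ℕ` onto `X`, given by its
graph; `IsName p x` says that `δ p` is defined and equal to `x`. -/
structure Naming (X : Type*) where
  IsName : (ℕ → ℕ) → X → Prop
  unique : ∀ {p x y}, IsName p x → IsName p y → x = y
  surj : ∀ x, ∃ p, IsName p x

/-- The partial function `F` on Baire space realizes the function `f`. -/
def IsRealizer {X Y : Type*} (A : Naming X) (B : Naming Y)
    (F : (ℕ → ℕ) →. (ℕ → ℕ)) (f : X → Y) : Prop :=
  ∀ p x, A.IsName p x → ∃ r ∈ F p, B.IsName r (f x)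

/-- `f` is computable: it has a computable realizer. -/
def IsComputable {X Y : Type*} (A : Naming X) (B : Naming Y) (f : X → Y) : Prop :=
  ∃ q : ℕ → ℕ, Computable q ∧ IsRealizer A B (assocFun q) f

/-- `f` is continuous (as a map of represented spaces): it has a realizer that is continuous on
its domain. -/
def IsContinuous {X Y : Type*} (A : Naming X) (B : Naming Y) (f : X → Y) : Prop :=
  ∃ F : (ℕ → ℕ) →. (ℕ → ℕ), Continuous F.asSubtype ∧ IsRealizer A B F f

theorem pre_eq_iff (p p' : ℕ → ℕ) (m : ℕ) : pre p m = pre p' m ↔ ∀ i < m, p i = p' i := by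
  simp [pre]

/-- Every continuous map has a realizer that is given by an associate. -/
theorem IsContinuous.exists_assoc {X Y : Type*} {A : Naming X} {B : Naming Y} {f : X → Y}
    (hf : IsContinuous A B f) : ∃ q, IsRealizer A B (assocFun q) f := by
  classical
  obtain ⟨F, hF, hr⟩ := hf
  let P : ℕ × List ℕ → ℕ → Prop := fun c v =>
    ∀ p r, r ∈ F p → pre p c.2.length = c.2 → r c.1 = v
  let g : ℕ × List ℕ → ℕ := fun c => if h : ∃ v, P c v then h.choose + 1 else 0
  let q : ℕ → ℕ := fun e => ((Encodable.decode e : Option (ℕ × List ℕ)).map g).getD 0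
  have hq : ∀ p n m, q (query p n m) = g (n, pre p m) := by
    intro p n m
    simp [q, query]
  have hlen : ∀ (p : ℕ → ℕ) m, (pre p m).length = m := by
    intro p m
    simp [pre]
  refine ⟨q, fun p x hp => ?_⟩
  obtain ⟨r, hrF, hrB⟩ := hr p x hp
  have hval : ∀ n m, q (query p n m) ≠ 0 → q (query p n m) = r n + 1 := by
    intro n m h
    rw [hq] at h ⊢
    by_cases hv : ∃ v, P (n, pre p m) v
    · have h1 : g (n, pre p m) = hv.choose + 1 := dif_pos hv
      rw [h1, ← hv.choose_spec p r hrF (by simp [hlen])]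
    · exact absurd (dif_neg hv) h
  have hdom : ∀ n, ∃ m, q (query p n m) ≠ 0 := by
    intro n
    have hc : Continuous fun a : F.Dom => F.asSubtype a n := (continuous_apply n).comp hF
    have hp0 : p ∈ F.Dom := (PFun.mem_dom F p).2 ⟨r, hrF⟩
    have hr0 : F.asSubtype ⟨p, hp0⟩ = r := Part.get_eq_of_mem hrF hp0
    obtain ⟨U, hU, hUe⟩ := (isOpen_discrete {r n}).preimage hc
    have hpU : p ∈ U := by
      have : (⟨p, hp0⟩ : F.Dom) ∈ Subtype.val ⁻¹' U := by
        rw [hUe]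
        simp [hr0]
      exact this
    obtain ⟨_, ⟨y, m, rfl⟩, hym, hcU⟩ :=
      (PiNat.isTopologicalBasis_cylinders (fun _ : ℕ => ℕ)).exists_subset_of_mem_open hpU hU
    refine ⟨m, ?_⟩
    rw [hq]
    have hv : ∃ v, P (n, pre p m) v := by
      refine ⟨r n, fun p' r' hr' hpre => ?_⟩
      rw [hlen, pre_eq_iff] at hpre
      have hp' : p' ∈ F.Dom := (PFun.mem_dom F p').2 ⟨r', hr'⟩
      have hr0' : F.asSubtype ⟨p', hp'⟩ = r' := Part.get_eq_of_mem hr' hp'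
      have hU' : (⟨p', hp'⟩ : F.Dom) ∈ Subtype.val ⁻¹' U := by
        refine hcU fun i hi => ?_
        change p' i = y i
        rw [hpre i hi]
        exact hym i hi
      rw [hUe] at hU'
      simpa [hr0'] using hU'
    have h1 : g (n, pre p m) = hv.choose + 1 := dif_pos hv
    rw [h1]
    exact Nat.succ_ne_zero _
  refine ⟨r, ⟨hdom, ?_⟩, hrB⟩
  funext n
  have h2 := hval n _ (Nat.find_spec (hdom n))
  change q (query p n (Nat.find (hdom n))) - 1 = r n
  rw [h2]
  rfl

/-- The continuous functions between two represented spaces. -/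
def ContMap {X Y : Type*} (A : Naming X) (B : Naming Y) := {f : X → Y // IsContinuous A B f}

instance {X Y : Type*} (A : Naming X) (B : Naming Y) : CoeFun (ContMap A B) fun _ => X → Y :=
  ⟨Subtype.val⟩

/-- The function space `C(X, Y)`: a name of `f` is (an associate of) a realizer of `f`. -/
def Naming.fn {X Y : Type*} (A : Naming X) (B : Naming Y) : Naming (ContMap A B) where
  IsName p f := IsRealizer A B (assocFun p) f
  unique {p f g} hf hg := by
    refine Subtype.ext (funext fun x => ?_)
    obtain ⟨a, ha⟩ := A.surj x
    obtain ⟨r, hr, hr'⟩ := hf a x ha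
    obtain ⟨s, hs, hs'⟩ := hg a x ha
    exact B.unique hr' (Part.mem_unique hs hr ▸ hs')
  surj f := f.2.exists_assoc

/-- The product of two represented spaces, with the names `⟨p, q⟩` where
`⟨p, q⟩ (2 n) = p n` and `⟨p, q⟩ (2 n + 1) = q n`. -/
def Naming.prod {X Y : Type*} (A : Naming X) (B : Naming Y) : Naming (X × Y) where
  IsName p z := A.IsName (fun n => p (2 * n)) z.1 ∧ B.IsName (fun n => p (2 * n + 1)) z.2
  unique h h' := Prod.ext (A.unique h.1 h'.1) (B.unique h.2 h'.2)
  surj z := by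
    obtain ⟨p, hp⟩ := A.surj z.1
    obtain ⟨q, hq⟩ := B.surj z.2
    refine ⟨fun n => if n % 2 = 0 then p (n / 2) else q (n / 2), ?_, ?_⟩
    · convert hp using 2 with n
      simp
    · convert hq using 2 with n
      have h1 : (2 * n + 1) % 2 = 1 := by omega
      have h2 : (2 * n + 1) / 2 = n := by omega
      simp [h1, h2]

/-- The space `X^*` of finite sequences: a name consists of the length of the sequence, followed
by names of its entries. -/
def Naming.list {X : Type*} (A : Naming X) : Naming (List X) where
  IsName p l := p 0 = l.length ∧
    ∀ (i : ℕ) (hi : i < l.length), A.IsName (fun m => p (Nat.pair i m + 1)) l[i]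
  unique h h' := List.ext_getElem (h.1.symm.trans h'.1) fun i hi hi' =>
    A.unique (h.2 i hi) (h'.2 i hi')
  surj l := by
    choose nm hnm using A.surj
    refine ⟨fun n => match n with
      | 0 => l.length
      | n + 1 => if h : n.unpair.1 < l.length then nm l[n.unpair.1] n.unpair.2 else 0, rfl, ?_⟩
    intro i hi
    have : (fun m => if h : (Nat.pair i m).unpair.1 < l.length then
        nm l[(Nat.pair i m).unpair.1] (Nat.pair i m).unpair.2 else 0) = nm l[i] := by
      funext m
      simp [hi]
    change A.IsName (fun m => if h : (Nat.pair i m).unpair.1 < l.length then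
        nm l[(Nat.pair i m).unpair.1] (Nat.pair i m).unpair.2 else 0) l[i]
    rw [this]
    exact hnm _

/-- A subset of a represented space. -/
def Naming.subtype {X : Type*} (A : Naming X) (P : X → Prop) : Naming {x // P x} where
  IsName p x := A.IsName p x.1
  unique h h' := Subtype.ext (A.unique h h')
  surj x := A.surj x.1

/-- The represented space `ℕ`. -/
def natNaming : Naming ℕ where
  IsName p n := p 0 = n
  unique h h' := h.symm.trans h'
  surj n := ⟨fun _ => n, rfl⟩

/-- The discrete space `{0, …, k - 1}`. -/
def finNaming (k : ℕ) : Naming (Fin k) where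
  IsName p i := p 0 = i
  unique h h' := Fin.ext (h.symm.trans h')
  surj i := ⟨fun _ => i, rfl⟩

/-- Sierpiński space (with `True` for `⊤` and `False` for `⊥`): the zero sequence is the only name
of `⊥`, and all other sequences are names of `⊤`. -/
def sierpinski : Naming Prop where
  IsName p b := b ↔ ∃ n, p n ≠ 0
  unique h h' := propext (h.trans h'.symm)
  surj b := by
    by_cases hb : b
    · exact ⟨fun _ => 1, by simp [hb]⟩
    · exact ⟨fun _ => 0, by simp [hb]⟩

/-- The space `k_⊥`: the zero sequence is the only name of `⊥`, and the names of a label `l < k`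
are the sequences `0^m 1^(l+1) 0^ω`. -/
def labelNaming (k : ℕ) : Naming (WithBot (Fin k)) where
  IsName p y := (y = ⊥ ∧ ∀ n, p n = 0) ∨
    ∃ l : Fin k, y = l ∧ ∃ m, ∀ n, p n = if m ≤ n ∧ n < m + (l + 1) then 1 else 0
  unique {p x y} h h' := by
    have key : ∀ (m : ℕ) (l : Fin k),
        (∀ n, p n = if m ≤ n ∧ n < m + (l + 1) then 1 else 0) → p m = 1 := by
      intro m l h
      rw [h, if_pos (by omega)]
    rcases h with ⟨rfl, h⟩ | ⟨l, rfl, m, h⟩ <;> rcases h' with ⟨rfl, h'⟩ | ⟨l', rfl, m', h'⟩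
    · rfl
    · have := key m' l' h'
      rw [h] at this
      omega
    · have := key m l h
      rw [h'] at this
      omega
    · have hiff : ∀ n, (m ≤ n ∧ n < m + (l + 1)) ↔ (m' ≤ n ∧ n < m' + (l' + 1)) := by
        intro n
        have h1 := h n
        rw [h' n] at h1
        split_ifs at h1 <;> tauto
      have e1 := hiff m
      have e2 := hiff m'
      have e3 := hiff (m + l)
      have e4 := hiff (m' + l')
      congr 1
      exact Fin.ext (by omega)
  surj y := by
    induction y using WithBot.recBotCoe with
    | bot => exact ⟨fun _ => 0, Or.inl ⟨rfl, fun _ => rfl⟩⟩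
    | coe l => exact ⟨_, Or.inr ⟨l, rfl, 0, fun _ => rfl⟩⟩

/-! ## Computable metric spaces -/

/-- The Cauchy representation of a metric space with a dense sequence `s`: the names of `x` are
the sequences of (indices of) points of `s` that converge to `x` with speed `2^(-n)`. -/
def cauchyNaming {X : Type*} [MetricSpace X] (s : ℕ → X) (hs : DenseRange s) : Naming X where
  IsName p x := ∀ n, dist (s (p n)) x ≤ (1 / 2 : ℝ) ^ n
  unique {p x y} h h' := by
    by_contra hne
    have hd : 0 < dist x y / 2 := half_pos (dist_pos.2 hne)
    obtain ⟨n, hn⟩ := exists_pow_lt_of_lt_one hd (by norm_num : (1 / 2 : ℝ) < 1)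
    have h1 := dist_triangle_left x y (s (p n))
    linarith [h n, h' n]
  surj x := by
    have : ∀ n : ℕ, ∃ i, dist (s i) x ≤ (1 / 2 : ℝ) ^ n := by
      intro n
      obtain ⟨i, hi⟩ := hs.exists_dist_lt x (by positivity : (0 : ℝ) < (1 / 2 : ℝ) ^ n)
      exact ⟨i, by rw [dist_comm]; exact hi.le⟩
    choose p hp using this
    exact ⟨p, hp⟩

/-- The standard enumeration of the rational numbers: the number that codes `((a, b), c)` is sent
to `(a - b) / (c + 1)`. -/
def ratSeq (n : ℕ) : ℚ :=
  ((n.unpair.1.unpair.1 : ℚ) - n.unpair.1.unpair.2) / (n.unpair.2 + 1)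

theorem ratSeq_surjective : Function.Surjective ratSeq := by
  intro r
  refine ⟨Nat.pair (Nat.pair r.num.toNat (-r.num).toNat) (r.den - 1), ?_⟩
  have h1 : ((r.num.toNat : ℕ) : ℚ) - ((-r.num).toNat : ℕ) = r.num := by
    exact_mod_cast Int.toNat_sub_toNat_neg r.num
  have h2 : (((r.den - 1 : ℕ) : ℚ) + 1) = r.den := by
    exact_mod_cast Nat.sub_add_cancel r.den_pos
  simp only [ratSeq, Nat.unpair_pair, h1, h2]
  exact Rat.num_div_den r

theorem denseRange_ratSeq : DenseRange fun n => (ratSeq n : ℝ) :=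
  Rat.denseRange_cast.comp ratSeq_surjective.denseRange Rat.continuous_coe_real

/-- The real numbers, represented by rational sequences that converge with speed `2^(-n)`. -/
def realNaming : Naming ℝ := cauchyNaming (fun n => (ratSeq n : ℝ)) denseRange_ratSeq

/-- The structure of a computable metric space on the metric space `X`: a dense sequence such that
the distances of its members form a computable double sequence of real numbers. -/
structure ComputableMetric (X : Type*) [MetricSpace X] where
  pt : ℕ → X
  dense : DenseRange pt
  dist_computable : ∃ g : ℕ × ℕ × ℕ → ℕ, Computable g ∧
    ∀ i j n, |(ratSeq (g (i, j, n)) : ℝ) - dist (pt i) (pt j)| ≤ (1 / 2 : ℝ) ^ n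

/-- The represented space of a computable metric space. -/
def ComputableMetric.naming {X : Type*} [MetricSpace X] (M : ComputableMetric X) : Naming X :=
  cauchyNaming M.pt M.dense

/-- The map from the open sets of a represented space (identified with the continuous maps to
Sierpiński space) to Sierpiński space that recognizes the whole space. -/
def isFull {X : Type*} (A : Naming X) (U : ContMap A sierpinski) : Prop := ∀ x, U x

/-- A represented space is computably compact iff `isFull` is computable. -/
def ComputablyCompact {X : Type*} (A : Naming X) : Prop :=
  IsComputable (A.fn sierpinski) sierpinski (isFull A)

/-! ## Learners, sparse and dense training data -/

/-- The space `(X × k)^*` of training data. -/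
def dataNaming {X : Type*} (A : Naming X) (k : ℕ) : Naming (List (X × Fin k)) :=
  (A.prod (finNaming k)).list

/-- The space `C(X, k_⊥)` of classifiers. -/
def classifierNaming {X : Type*} (A : Naming X) (k : ℕ) : Naming (ContMap A (labelNaming k)) :=
  A.fn (labelNaming k)

/-- Learners: continuous maps from training data to classifiers. -/
abbrev Learner {X : Type*} (A : Naming X) (k : ℕ) :=
  ContMap (dataNaming A k) (classifierNaming A k)

/-- The space `C((X × k)^*, C(X, k_⊥))` of learners. -/
def learnerNaming {X : Type*} (A : Naming X) (k : ℕ) : Naming (Learner A k) :=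
  (dataNaming A k).fn (classifierNaming A k)

/-- The training data `data` is sparse at `x`: two extensions by at most `N` points at distance
greater than `ε` from `x` lead to different labels of `x`. -/
def SparseAt {X : Type*} [MetricSpace X] {A : Naming X} {k : ℕ} (L : Learner A k) (N : ℕ) (ε : ℝ)
    (data : List (X × Fin k)) (x : X) : Prop :=
  ∃ a b : List (X × Fin k), a.length ≤ N ∧ b.length ≤ N ∧
    (∀ y ∈ a, ε < dist y.1 x) ∧ (∀ y ∈ b, ε < dist y.1 x) ∧
    L (data ++ a) x ≠ ⊥ ∧ L (data ++ a) x ≠ L (data ++ b) x ∧ L (data ++ b) x ≠ ⊥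

/-- The training data `data` is dense at `x`: all extensions by at most `N` points at distance at
least `ε` from `x` lead to the same label of `x`. -/
def DenseAt {X : Type*} [MetricSpace X] {A : Naming X} {k : ℕ} (L : Learner A k) (N : ℕ) (ε : ℝ)
    (data : List (X × Fin k)) (x : X) : Prop :=
  ∀ a b : List (X × Fin k), a.length ≤ N → b.length ≤ N →
    (∀ y ∈ a, ε ≤ dist y.1 x) → (∀ y ∈ b, ε ≤ dist y.1 x) →
    L (data ++ a) x = L (data ++ b) x ∧ L (data ++ a) x ≠ ⊥

end CompAnalysis

open CompAnalysis

/-! Sparseness and denseness are both semidecidable from a name of the input, and they exclude each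
other (`not_denseAt_of_sparseAt`). The two semidecision procedures can therefore run in parallel,
and `isComputable_of_semidec` merges them into one realizer with values in `2_⊥`.

Sparseness is existential, and what it asks of an extension is open: "distance greater than `ε`" and
"the resulting label is `l`" are confirmed by finitely many digits. A confirmation sees only a
prefix of a name of the extension, and `exists_isName_forall_prefix` continues this prefix to a name
of a list of labelled members of the dense sequence. Searching the countably many such lists is
enough (`sparseAt_iff`).

Denseness is a universal statement over a compact set. It says that for some label `l`, every
candidate name `Q` below a fixed bound is not a name of training data, or names a point at distance
less than `ε`, or leads to `l` (`denseAt_iff`). All three alternatives are open, the second because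
denseness uses the weak inequality. Computable compactness enters twice: it yields a computable
bound for some name of every short list (`exists_computable_cover`, `exists_isName_le_nameBound`),
and it yields completeness, so that a sequence refuted by no finite part really is a name
(`exists_isName_of_not_refutedName`). Quantification over all sequences below a computable bound
preserves semidecidability by Tychonoff's theorem and an enumeration of prefixes
(`Semidec.forall_le`). -/

namespace CompAnalysis

/-! ## Computability of functions between countable types -/

attribute [fun_prop] Computable Computable.id Computable.const Computable.comp Computable.pair

section Computable

variable {α β γ : Type*} [Primcodable α] [Primcodable β] [Primcodable γ]

@[fun_prop]
theorem computable_fst {f : α → β × γ} (hf : Computable f) : Computable fun a => (f a).1 :=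
  Computable.fst.comp hf

@[fun_prop]
theorem computable_snd {f : α → β × γ} (hf : Computable f) : Computable fun a => (f a).2 :=
  Computable.snd.comp hf

@[fun_prop]
theorem computable_add {f g : α → ℕ} (hf : Computable f) (hg : Computable g) :
    Computable fun a => f a + g a :=
  Primrec.nat_add.to_comp.comp hf hg

@[fun_prop]
theorem computable_mul {f g : α → ℕ} (hf : Computable f) (hg : Computable g) :
    Computable fun a => f a * g a :=
  Primrec.nat_mul.to_comp.comp hf hg

@[fun_prop]
theorem computable_sub {f g : α → ℕ} (hf : Computable f) (hg : Computable g) :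
    Computable fun a => f a - g a :=
  Primrec.nat_sub.to_comp.comp hf hg

@[fun_prop]
theorem computable_div {f g : α → ℕ} (hf : Computable f) (hg : Computable g) :
    Computable fun a => f a / g a :=
  Primrec.nat_div.to_comp.comp hf hg

@[fun_prop]
theorem computable_mod {f g : α → ℕ} (hf : Computable f) (hg : Computable g) :
    Computable fun a => f a % g a :=
  Primrec.nat_mod.to_comp.comp hf hg

@[fun_prop]
theorem computable_max {f g : α → ℕ} (hf : Computable f) (hg : Computable g) :
    Computable fun a => max (f a) (g a) :=
  Primrec.nat_max.to_comp.comp hf hg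

@[fun_prop]
theorem computable_pow {f g : α → ℕ} (hf : Computable f) (hg : Computable g) :
    Computable fun a => f a ^ g a := by
  have h : Computable fun a => Nat.rec (motive := fun _ => ℕ) 1 (fun _ ih => ih * f a) (g a) :=
    Computable.nat_rec hg (Computable.const 1)
      (Computable.to₂ (f := fun p : α × ℕ × ℕ => p.2.2 * f p.1) (by fun_prop))
  refine h.of_eq fun a => ?_
  induction g a with
  | zero => rfl
  | succ n ih => rw [pow_succ, ← ih]

@[fun_prop]
theorem computable_natPair {f g : α → ℕ} (hf : Computable f) (hg : Computable g) :
    Computable fun a => Nat.pair (f a) (g a) :=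
  Primrec₂.natPair.to_comp.comp hf hg

@[fun_prop]
theorem computable_natUnpair {f : α → ℕ} (hf : Computable f) :
    Computable fun a => Nat.unpair (f a) :=
  Computable.unpair.comp hf

@[fun_prop]
theorem computable_decode {f : α → ℕ} (hf : Computable f) :
    Computable fun a => (Encodable.decode (f a) : Option β) :=
  Computable.decode.comp hf

@[fun_prop]
theorem computable_some {f : α → β} (hf : Computable f) : Computable fun a => some (f a) :=
  Computable.option_some.comp hf

@[fun_prop]
theorem computable_getElem? {f : α → List β} {g : α → ℕ} (hf : Computable f)
    (hg : Computable g) : Computable fun a => (f a)[g a]? :=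
  Computable.list_getElem?.comp hf hg

@[fun_prop]
theorem computable_length {f : α → List β} (hf : Computable f) :
    Computable fun a => (f a).length :=
  Computable.list_length.comp hf

@[fun_prop]
theorem computable_take {f : α → List β} {g : α → ℕ} (hf : Computable f) (hg : Computable g) :
    Computable fun a => (f a).take (g a) :=
  Primrec.list_take.to_comp.comp hg hf

@[fun_prop]
theorem computable_getD {f : α → Option β} {g : α → β} (hf : Computable f) (hg : Computable g) :
    Computable fun a => (f a).getD (g a) :=
  Computable.option_getD hf hg

@[fun_prop]
theorem computable_bool_and {f g : α → Bool} (hf : Computable f) (hg : Computable g) :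
    Computable fun a => f a && g a :=
  Primrec.and.to_comp.comp hf hg

@[fun_prop]
theorem computable_bool_or {f g : α → Bool} (hf : Computable f) (hg : Computable g) :
    Computable fun a => f a || g a :=
  Primrec.or.to_comp.comp hf hg

@[fun_prop]
theorem computable_bool_not {f : α → Bool} (hf : Computable f) : Computable fun a => !(f a) :=
  Primrec.not.to_comp.comp hf

@[fun_prop]
theorem computable_decide_eq [DecidableEq β] {f g : α → β} (hf : Computable f)
    (hg : Computable g) : Computable fun a => decide (f a = g a) :=
  (PrimrecPred.decide (α := β × β) (Primrec.eq (α := β))).to_comp.comp (hf.pair hg)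

@[fun_prop]
theorem computable_ble {f g : α → ℕ} (hf : Computable f) (hg : Computable g) :
    Computable fun a => Nat.ble (f a) (g a) :=
  ((PrimrecPred.decide (α := ℕ × ℕ) Primrec.nat_le).to_comp.comp (hf.pair hg)).of_eq fun a => by
    rw [Bool.eq_iff_iff, decide_eq_true_eq, Nat.ble_eq]

@[fun_prop]
theorem computable_cond {b : α → Bool} {f g : α → β} (hb : Computable b) (hf : Computable f)
    (hg : Computable g) : Computable fun a => bif b a then f a else g a :=
  Computable.cond hb hf hg

/-- Bounded search for a witness. -/
def anyLt (f : ℕ → Bool) (n : ℕ) : Bool :=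
  Nat.rec (motive := fun _ => Bool) false (fun m ih => ih || f m) n

theorem anyLt_iff (f : ℕ → Bool) (n : ℕ) : anyLt f n = true ↔ ∃ m < n, f m = true := by
  induction n with
  | zero => simp [anyLt]
  | succ n ih =>
    have h : anyLt f (n + 1) = (anyLt f n || f n) := rfl
    rw [h, Bool.or_eq_true, ih]
    constructor
    · rintro (⟨m, hm, h⟩ | h)
      · exact ⟨m, by omega, h⟩
      · exact ⟨n, by omega, h⟩
    · rintro ⟨m, hm, hfm⟩
      rcases Nat.lt_succ_iff_lt_or_eq.1 hm with h' | rfl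
      · exact Or.inl ⟨m, h', hfm⟩
      · exact Or.inr hfm

theorem computable_anyLt {f : α → ℕ → Bool} {n : α → ℕ}
    (hf : Computable fun p : α × ℕ => f p.1 p.2) (hn : Computable n) :
    Computable fun a => anyLt (f a) (n a) :=
  Computable.nat_rec hn (Computable.const false)
    (Computable.to₂ (f := fun p : α × ℕ × Bool => (p.2.2 || f p.1 p.2.1)) (by
      have : Computable fun p : α × ℕ × Bool => f p.1 p.2.1 :=
        hf.comp (f := fun q : α × ℕ => f q.1 q.2) (g := fun p : α × ℕ × Bool => (p.1, p.2.1))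
          (by fun_prop)
      fun_prop))

/-- A total computable search. -/
theorem exists_computable_find {b : α → ℕ → Bool} (hb : Computable fun p : α × ℕ => b p.1 p.2)
    (h : ∀ a, ∃ n, b a n = true) : ∃ f : α → ℕ, Computable f ∧ ∀ a, b a (f a) = true := by
  refine ⟨fun a => Nat.find (h a), ?_, fun a => Nat.find_spec (h a)⟩
  have hp : Partrec₂ fun a n => (Part.some (b a n) : Part Bool) := hb
  refine (Partrec.rfind hp).of_eq_tot fun a => ?_
  refine Nat.mem_rfind.2 ⟨?_, fun {m} hm => ?_⟩
  · simp [Nat.find_spec (h a)]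
  · simpa using Nat.find_min (h a) hm

end Computable

/-! ## Semidecidable relations on Baire space -/

section Semidec

variable {α β γ : Type*} [Primcodable α] [Primcodable β] [Primcodable γ]

theorem length_pre (P : ℕ → ℕ) (m : ℕ) : (pre P m).length = m := by simp [pre]

theorem getElem?_pre (P : ℕ → ℕ) (m i v : ℕ) : (pre P m)[i]? = some v ↔ i < m ∧ P i = v := by
  simp [pre, List.getElem?_eq_some_iff]

theorem take_pre (P : ℕ → ℕ) {m n : ℕ} (h : m ≤ n) : (pre P n).take m = pre P m := by
  apply List.ext_getElem?
  intro i
  ext v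
  rw [List.getElem?_take, getElem?_pre]
  split_ifs with hi
  · rw [getElem?_pre]
    exact ⟨fun h' => ⟨hi, h'.2⟩, fun h' => ⟨by omega, h'.2⟩⟩
  · simp [hi]

theorem pre_congr {P Q : ℕ → ℕ} {m : ℕ} (h : ∀ i < m, P i = Q i) : pre P m = pre Q m :=
  (pre_eq_iff P Q m).2 h

/-- A relation between sequences and elements of a countable type is semidecidable if it is
recognized by an algorithm that reads prefixes of the sequence. -/
def Semidec (R : (ℕ → ℕ) → α → Prop) : Prop :=
  ∃ S : List ℕ × α → Bool, Computable S ∧ ∀ P a, R P a ↔ ∃ m, S (pre P m, a) = true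

theorem Semidec.of_iff {R R' : (ℕ → ℕ) → α → Prop} (h : Semidec R)
    (H : ∀ P a, R' P a ↔ R P a) : Semidec R' := by
  obtain ⟨S, hS, hR⟩ := h
  exact ⟨S, hS, fun P a => (H P a).trans (hR P a)⟩

/-- Rerunning the recognizer on all shorter prefixes makes acceptance permanent. Conjunctions,
bounded quantifiers and the compactness argument need this to bring several acceptances to a common
stage. -/
theorem Semidec.exists_mono {R : (ℕ → ℕ) → α → Prop} (h : Semidec R) :
    ∃ S : List ℕ × α → Bool, Computable S ∧ (∀ P a, R P a ↔ ∃ m, S (pre P m, a) = true) ∧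
      ∀ P a m n, m ≤ n → S (pre P m, a) = true → S (pre P n, a) = true := by
  obtain ⟨S, hS, hR⟩ := h
  have key : ∀ P a n, anyLt (fun m => S ((pre P n).take m, a)) ((pre P n).length + 1) = true ↔
      ∃ m ≤ n, S (pre P m, a) = true := by
    intro P a n
    rw [anyLt_iff, length_pre]
    constructor
    · rintro ⟨m, hm, h⟩
      rw [take_pre P (by omega)] at h
      exact ⟨m, by omega, h⟩
    · rintro ⟨m, hm, h⟩
      exact ⟨m, by omega, by rwa [take_pre P hm]⟩
  refine ⟨fun x => anyLt (fun m => S (x.1.take m, x.2)) (x.1.length + 1), ?_, ?_, ?_⟩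
  · exact computable_anyLt (f := fun (x : List ℕ × α) m => S (x.1.take m, x.2))
      (by fun_prop) (by fun_prop)
  · intro P a
    simp only [key, hR]
    exact ⟨fun ⟨m, h⟩ => ⟨m, m, le_rfl, h⟩, fun ⟨_, m, _, h⟩ => ⟨m, h⟩⟩
  · intro P a m n hmn
    simp only [key]
    rintro ⟨i, hi, h⟩
    exact ⟨i, hi.trans hmn, h⟩

/-! ### Closure properties and relative computability -/

theorem Semidec.of_computable {b : α → Bool} (hb : Computable b) :
    Semidec fun _ a => b a = true :=
  ⟨fun x => b x.2, by fun_prop, by simp⟩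

theorem Semidec.comp {R : (ℕ → ℕ) → β → Prop} (hR : Semidec R) {f : α → β} (hf : Computable f) :
    Semidec fun P a => R P (f a) := by
  obtain ⟨S, hS, h⟩ := hR
  exact ⟨fun x => S (x.1, f x.2), by fun_prop, fun P a => h P (f a)⟩

theorem semidec_eval : Semidec fun P (x : ℕ × ℕ) => P x.1 = x.2 := by
  refine ⟨fun x => decide (x.1[x.2.1]? = some x.2.2), by fun_prop, fun P x => ?_⟩
  simp only [decide_eq_true_eq, getElem?_pre]
  exact ⟨fun h => ⟨x.1 + 1, by omega, h⟩, fun ⟨_, _, h⟩ => h⟩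

theorem Semidec.and {R R' : (ℕ → ℕ) → α → Prop} (hR : Semidec R) (hR' : Semidec R') :
    Semidec fun P a => R P a ∧ R' P a := by
  obtain ⟨S, hS, h, hm⟩ := hR.exists_mono
  obtain ⟨S', hS', h', hm'⟩ := hR'.exists_mono
  refine ⟨fun x => S x && S' x, by fun_prop, fun P a => ?_⟩
  simp only [h, h', Bool.and_eq_true]
  constructor
  · rintro ⟨⟨m, hS⟩, ⟨n, hS'⟩⟩
    exact ⟨max m n, hm _ _ _ _ (le_max_left _ _) hS, hm' _ _ _ _ (le_max_right _ _) hS'⟩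
  · rintro ⟨m, hS, hS'⟩
    exact ⟨⟨m, hS⟩, ⟨m, hS'⟩⟩

theorem Semidec.or {R R' : (ℕ → ℕ) → α → Prop} (hR : Semidec R) (hR' : Semidec R') :
    Semidec fun P a => R P a ∨ R' P a := by
  obtain ⟨S, hS, h⟩ := hR
  obtain ⟨S', hS', h'⟩ := hR'
  refine ⟨fun x => S x || S' x, by fun_prop, fun P a => ?_⟩
  simp only [h, h', Bool.or_eq_true, exists_or]

/-- Dovetailing: the length of the prefix read so far also bounds the search for the witness. -/
theorem Semidec.exists_nat {R : (ℕ → ℕ) → α → ℕ → Prop}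
    (hR : Semidec fun P (x : α × ℕ) => R P x.1 x.2) : Semidec fun P a => ∃ n, R P a n := by
  obtain ⟨S, hS, h, hm⟩ := hR.exists_mono
  refine ⟨fun x => anyLt (fun n => S (x.1, (x.2, n))) x.1.length, ?_, fun P a => ?_⟩
  · exact computable_anyLt (f := fun (x : List ℕ × α) n => S (x.1, (x.2, n)))
      (by fun_prop) (by fun_prop)
  · have h' : ∀ n, R P a n ↔ ∃ m, S (pre P m, (a, n)) = true := fun n => h P (a, n)
    simp only [h', anyLt_iff, length_pre]
    constructor
    · rintro ⟨n, m, hS⟩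
      exact ⟨max m (n + 1), n, by omega, hm _ _ _ _ (le_max_left _ _) hS⟩
    · rintro ⟨m, n, _, hS⟩
      exact ⟨n, m, hS⟩

theorem Semidec.exists {R : (ℕ → ℕ) → α → β → Prop}
    (hR : Semidec fun P (x : α × β) => R P x.1 x.2) : Semidec fun P a => ∃ b, R P a b := by
  obtain ⟨S, hS, h⟩ := hR
  let T : List ℕ × (α × ℕ) → Bool := fun x =>
    ((Encodable.decode x.2.2 : Option β).map fun b => S (x.1, (x.2.1, b))).getD false
  have hT : Computable T := by
    refine computable_getD (Computable.option_map ?_ ?_) ?_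
    · fun_prop
    · change Computable fun p : (List ℕ × (α × ℕ)) × β => S (p.1.1, (p.1.2.1, p.2))
      fun_prop
    · fun_prop
  have := Semidec.exists_nat (R := fun P a n => ∃ m, T (pre P m, (a, n)) = true)
    ⟨T, hT, fun P x => Iff.rfl⟩
  refine this.of_iff fun P a => ?_
  have h' : ∀ b, R P a b ↔ ∃ m, S (pre P m, (a, b)) = true := fun b => h P (a, b)
  simp only [h']
  constructor
  · rintro ⟨b, m, hS⟩
    exact ⟨Encodable.encode b, m, by simp [T, hS]⟩
  · rintro ⟨n, m, hS⟩
    cases hd : (Encodable.decode n : Option β) with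
    | none => simp [T, hd] at hS
    | some b => exact ⟨b, m, by simpa [T, hd] using hS⟩

/-- Finitely many acceptances share a stage, namely the maximum of their stages, because the
recognizer is monotone. -/
theorem Semidec.forall_lt {R : (ℕ → ℕ) → α → ℕ → Prop}
    (hR : Semidec fun P (x : α × ℕ) => R P x.1 x.2) {n : α → ℕ} (hn : Computable n) :
    Semidec fun P a => ∀ i < n a, R P a i := by
  obtain ⟨S, hS, h, hm⟩ := hR.exists_mono
  refine ⟨fun x => !anyLt (fun i => !S (x.1, (x.2, i))) (n x.2), ?_, fun P a => ?_⟩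
  · exact computable_bool_not (computable_anyLt
      (f := fun (x : List ℕ × α) i => !S (x.1, (x.2, i))) (by fun_prop) (by fun_prop))
  · have h' : ∀ n, R P a n ↔ ∃ m, S (pre P m, (a, n)) = true := fun n => h P (a, n)
    have h2 : ∀ m, ((!anyLt (fun i => !S (pre P m, (a, i))) (n a)) = true) ↔
        ∀ i < n a, S (pre P m, (a, i)) = true := by
      intro m
      rw [Bool.not_eq_true', ← Bool.not_eq_true, anyLt_iff]
      simp
    simp only [h2, h']
    constructor
    · intro H
      choose! f hf using H
      refine ⟨(Finset.range (n a)).sup f, fun i hi => hm _ _ _ _ ?_ (hf i hi)⟩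
      exact Finset.le_sup (Finset.mem_range.2 hi)
    · rintro ⟨m, H⟩ i hi
      exact ⟨m, H i hi⟩

/-- A map that is computable relative to an oracle. -/
def RelComputable (Φ : (ℕ → ℕ) → α → β) : Prop :=
  Semidec fun P (x : α × β) => Φ P x.1 = x.2

theorem RelComputable.of_computable {f : α → β} (hf : Computable f) :
    RelComputable fun _ a => f a := by
  classical
  refine (Semidec.of_computable (b := fun x : α × β => decide (f x.1 = x.2)) ?_).of_iff ?_
  · fun_prop
  · simp

/-- `RelComputable` speaks of the graph, so the value can be guessed by an existential quantifier
and then checked. -/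
theorem Semidec.subst {R : (ℕ → ℕ) → β → Prop} (hR : Semidec R) {Φ : (ℕ → ℕ) → α → β}
    (hΦ : RelComputable Φ) : Semidec fun P a => R P (Φ P a) := by
  refine (Semidec.exists (R := fun P a b => Φ P a = b ∧ R P b)
    (Semidec.and hΦ (hR.comp Computable.snd))).of_iff fun P a => ?_
  simp

theorem RelComputable.comp {Φ : (ℕ → ℕ) → β → γ} (hΦ : RelComputable Φ) {Ψ : (ℕ → ℕ) → α → β}
    (hΨ : RelComputable Ψ) : RelComputable fun P a => Φ P (Ψ P a) := by
  refine (Semidec.exists (R := fun P (x : α × γ) b => Ψ P x.1 = b ∧ Φ P b = x.2)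
    (Semidec.and ?_ ?_)).of_iff fun P a => ?_
  · exact Semidec.comp hΨ (f := fun y : (α × γ) × β => (y.1.1, y.2)) (by fun_prop)
  · exact Semidec.comp hΦ (f := fun y : (α × γ) × β => (y.2, y.1.2)) (by fun_prop)
  · simp

theorem RelComputable.map {Φ : (ℕ → ℕ) → α → β} (hΦ : RelComputable Φ) {f : β → γ}
    (hf : Computable f) : RelComputable fun P a => f (Φ P a) :=
  RelComputable.comp (RelComputable.of_computable hf) hΦ

theorem RelComputable.pair {Φ : (ℕ → ℕ) → α → β} {Ψ : (ℕ → ℕ) → α → γ} (hΦ : RelComputable Φ)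
    (hΨ : RelComputable Ψ) : RelComputable fun P a => (Φ P a, Ψ P a) := by
  refine (Semidec.and
    (Semidec.comp hΦ (f := fun y : α × (β × γ) => (y.1, y.2.1)) (by fun_prop))
    (Semidec.comp hΨ (f := fun y : α × (β × γ) => (y.1, y.2.2)) (by fun_prop))).of_iff
    fun P a => ?_
  exact Prod.ext_iff

theorem relComputable_apply {Φ : (ℕ → ℕ) → α → ℕ} (hΦ : RelComputable Φ) :
    RelComputable fun P a => P (Φ P a) :=
  RelComputable.comp (Φ := fun P (n : ℕ) => P n) semidec_eval hΦ

theorem RelComputable.comp_computable {Φ : (ℕ → ℕ) → β → γ} (hΦ : RelComputable Φ) {f : α → β}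
    (hf : Computable f) : RelComputable fun P a => Φ P (f a) :=
  hΦ.comp (RelComputable.of_computable hf)

theorem Semidec.eq_of_relComputable {Φ Ψ : (ℕ → ℕ) → α → β} (hΦ : RelComputable Φ)
    (hΨ : RelComputable Ψ) : Semidec fun P a => Φ P a = Ψ P a :=
  Semidec.subst (R := fun P (x : α × β) => Φ P x.1 = x.2) hΦ
    (Φ := fun P a => (a, Ψ P a)) ((RelComputable.of_computable Computable.id).pair hΨ)

/-- Bounded quantification with a bound computed relative to the oracle. -/
theorem Semidec.forall_lt_rel {R : (ℕ → ℕ) → α → ℕ → Prop}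
    (hR : Semidec fun P (x : α × ℕ) => R P x.1 x.2) {n : (ℕ → ℕ) → α → ℕ}
    (hn : RelComputable n) : Semidec fun P a => ∀ i < n P a, R P a i := by
  have h : Semidec fun P (x : α × ℕ) => ∀ i < x.2, R P x.1 i :=
    Semidec.forall_lt (R := fun P (x : α × ℕ) i => R P x.1 i)
      (hR.comp (f := fun y : (α × ℕ) × ℕ => (y.1.1, y.2)) (by fun_prop)) Computable.snd
  exact h.subst ((RelComputable.of_computable Computable.id).pair hn)

theorem eq_pre_iff (p : ℕ → ℕ) (m : ℕ) (u : List ℕ) :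
    pre p m = u ↔ u.length = m ∧ ∀ i < m, u[i]? = some (p i) := by
  constructor
  · rintro rfl
    exact ⟨length_pre _ _, fun i hi => (getElem?_pre _ _ _ _).2 ⟨hi, rfl⟩⟩
  · rintro ⟨hl, h⟩
    refine List.ext_getElem? fun i => ?_
    by_cases hi : i < m
    · rw [h i hi]
      exact (getElem?_pre _ _ _ _).2 ⟨hi, rfl⟩
    · rw [List.getElem?_eq_none (by rw [length_pre]; omega), List.getElem?_eq_none (by omega)]

theorem relComputable_pre {Φ : (ℕ → ℕ) → α → ℕ → ℕ}
    (hΦ : RelComputable fun P (x : α × ℕ) => Φ P x.1 x.2) :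
    RelComputable fun P (x : α × ℕ) => pre (Φ P x.1) x.2 := by
  have h3 : RelComputable fun P (y : ((α × ℕ) × List ℕ) × ℕ) => some (Φ P y.1.1.1 y.2) :=
    (hΦ.comp_computable (f := fun y : ((α × ℕ) × List ℕ) × ℕ => (y.1.1.1, y.2))
      (by fun_prop)).map Computable.option_some
  have h4 : RelComputable fun (_ : ℕ → ℕ) (y : ((α × ℕ) × List ℕ) × ℕ) => y.1.2[y.2]? :=
    RelComputable.of_computable (by fun_prop)
  have h1 : Semidec fun P (x : (α × ℕ) × List ℕ) => ∀ i < x.1.2,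
      x.2[i]? = some (Φ P x.1.1 i) :=
    Semidec.forall_lt (R := fun P (x : (α × ℕ) × List ℕ) i => x.2[i]? = some (Φ P x.1.1 i))
      (n := fun x => x.1.2) (Semidec.eq_of_relComputable h4 h3) (by fun_prop)
  have h2 : Semidec fun (_ : ℕ → ℕ) (x : (α × ℕ) × List ℕ) =>
      decide (x.2.length = x.1.2) = true :=
    Semidec.of_computable (by fun_prop)
  refine (h2.and h1).of_iff fun P x => ?_
  rw [eq_pre_iff, decide_eq_true_eq]

/-- Substitution of a sequence that is computable relative to the oracle. -/
theorem Semidec.subst_oracle {R : (ℕ → ℕ) → α → Prop} (hR : Semidec R)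
    {Φ : (ℕ → ℕ) → α → ℕ → ℕ} (hΦ : RelComputable fun P (x : α × ℕ) => Φ P x.1 x.2) :
    Semidec fun P a => R (Φ P a) a := by
  obtain ⟨S, hS, h⟩ := hR
  refine (Semidec.exists (R := fun P a m => S (pre (Φ P a) m, a) = true)
    ?_).of_iff fun P a => h _ _
  exact (Semidec.of_computable hS).subst (Φ := fun P (x : α × ℕ) =>
    (pre (Φ P x.1) x.2, x.1)) ((relComputable_pre hΦ).pair
      (RelComputable.of_computable Computable.fst))

/-! ## Universal quantification over compact sets of sequences -/

/-- The sequence that interleaves `P` and `Q`. -/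
def join (P Q : ℕ → ℕ) (n : ℕ) : ℕ := bif decide (n % 2 = 0) then P (n / 2) else Q (n / 2)

theorem join_even (P Q : ℕ → ℕ) (n : ℕ) : join P Q (2 * n) = P n := by
  simp [join]

theorem join_odd (P Q : ℕ → ℕ) (n : ℕ) : join P Q (2 * n + 1) = Q n := by
  have h1 : (2 * n + 1) % 2 = 1 := by omega
  have h2 : (2 * n + 1) / 2 = n := by omega
  simp [join, h1, h2]

theorem join_congr {P Q Q' : ℕ → ℕ} {m : ℕ} (h : ∀ i < m, Q i = Q' i) :
    ∀ i < m, join P Q i = join P Q' i := by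
  intro i hi
  simp only [join]
  rw [h (i / 2) (by omega)]

theorem relComputable_cond {b : (ℕ → ℕ) → α → Bool} (hb : RelComputable b)
    {Φ Ψ : (ℕ → ℕ) → α → β} (hΦ : RelComputable Φ) (hΨ : RelComputable Ψ) :
    RelComputable fun P a => bif b P a then Φ P a else Ψ P a :=
  (hb.pair (hΦ.pair hΨ)).map
    (f := fun x : Bool × β × β => bif x.1 then x.2.1 else x.2.2) (by fun_prop)

theorem relComputable_join {Q : (ℕ → ℕ) → α → ℕ → ℕ}
    (hQ : RelComputable fun P (x : α × ℕ) => Q P x.1 x.2) :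
    RelComputable fun P (x : α × ℕ) => join P (Q P x.1) x.2 := by
  refine relComputable_cond (RelComputable.of_computable (by fun_prop)) ?_ ?_
  · exact relComputable_apply (RelComputable.of_computable (by fun_prop))
  · exact hQ.comp_computable (f := fun x : α × ℕ => (x.1, x.2 / 2)) (by fun_prop)

/-- The digits of `c` in base `b`, reduced so that they are bounded by `B`. -/
def boundedDigits (B : ℕ → ℕ) (b c i : ℕ) : ℕ := c / b ^ i % b % (B i + 1)

theorem boundedDigits_le (B : ℕ → ℕ) (b c i : ℕ) : boundedDigits B b c i ≤ B i :=
  Nat.lt_succ_iff.1 (Nat.mod_lt _ (Nat.succ_pos _))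

theorem exists_digits (b t : ℕ) (Q : ℕ → ℕ) (h : ∀ i < t, Q i < b) :
    ∃ c < b ^ t, ∀ i < t, c / b ^ i % b = Q i := by
  induction t generalizing Q with
  | zero => exact ⟨0, by simp, by simp⟩
  | succ t ih =>
    obtain ⟨c, hc, hcQ⟩ := ih (fun i => Q (i + 1)) fun i hi => h (i + 1) (by omega)
    have h0 : Q 0 < b := h 0 (by omega)
    refine ⟨Q 0 + b * c, ?_, fun i hi => ?_⟩
    · have : b * (c + 1) ≤ b * b ^ t := Nat.mul_le_mul_left b hc
      rw [pow_succ, mul_comm (b ^ t)]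
      rw [mul_add, mul_one] at this
      omega
    · cases i with
      | zero => simp [Nat.mod_eq_of_lt h0]
      | succ i =>
        have h1 : (Q 0 + b * c) / b = c := by
          rw [Nat.add_mul_div_left _ _ (by omega), Nat.div_eq_of_lt h0, zero_add]
        rw [pow_succ', ← Nat.div_div_eq_div_mul, h1]
        exact hcQ i (by omega)

/-- The codes below `b ^ t` reach all prefixes of bounded sequences, while the reduction modulo `B i
+ 1` ensures that no code leaves the bounded set. Quantifying over codes thus neither misses nor
adds a prefix. -/
theorem exists_boundedDigits (B : ℕ → ℕ) (b t : ℕ) (hb : ∀ i < t, B i < b) (Q : ℕ → ℕ)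
    (hQ : ∀ i, Q i ≤ B i) : ∃ c < b ^ t, ∀ i < t, boundedDigits B b c i = Q i := by
  obtain ⟨c, hc, h⟩ := exists_digits b t Q fun i hi => (hQ i).trans_lt (hb i hi)
  refine ⟨c, hc, fun i hi => ?_⟩
  rw [boundedDigits, h i hi, Nat.mod_eq_of_lt (Nat.lt_succ_iff.2 (hQ i))]

/-- Universal quantification over a computably compact set of sequences preserves
semidecidability. -/
theorem Semidec.forall_le {R : (ℕ → ℕ) → α → Prop} (hR : Semidec R) {B : α → ℕ → ℕ}
    (hB : Computable fun x : α × ℕ => B x.1 x.2) :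
    Semidec fun P a => ∀ Q : ℕ → ℕ, (∀ i, Q i ≤ B a i) → R (join P Q) a := by
  obtain ⟨S, hS, hRS, hmono⟩ := hR.exists_mono
  have hdig : RelComputable fun P (x : ((α × ℕ × ℕ) × ℕ) × ℕ) =>
      join P (boundedDigits (B x.1.1.1) x.1.1.2.2 x.1.2) x.2 := by
    refine relComputable_join (Q := fun _ (x : (α × ℕ × ℕ) × ℕ) =>
      boundedDigits (B x.1.1) x.1.2.2 x.2) (RelComputable.of_computable ?_)
    have : Computable fun y : ((α × ℕ × ℕ) × ℕ) × ℕ => B y.1.1.1 y.2 :=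
      hB.comp (g := fun y : ((α × ℕ × ℕ) × ℕ) × ℕ => (y.1.1.1, y.2)) (by fun_prop)
    unfold boundedDigits
    fun_prop
  have hpre : RelComputable fun P (x : (α × ℕ × ℕ) × ℕ) =>
      pre (join P (boundedDigits (B x.1.1) x.1.2.2 x.2)) x.1.2.1 :=
    (relComputable_pre (Φ := fun P (x : (α × ℕ × ℕ) × ℕ) =>
      join P (boundedDigits (B x.1.1) x.1.2.2 x.2)) hdig).comp_computable
      (f := fun x : (α × ℕ × ℕ) × ℕ => (x, x.1.2.1)) (by fun_prop)
  have hfst : RelComputable fun (_ : ℕ → ℕ) (x : (α × ℕ × ℕ) × ℕ) => x.1.1 :=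
    RelComputable.of_computable (by fun_prop)
  have h0 : Semidec fun P (x : (α × ℕ × ℕ) × ℕ) =>
      S (pre (join P (boundedDigits (B x.1.1) x.1.2.2 x.2)) x.1.2.1, x.1.1) = true :=
    (Semidec.of_computable hS).subst (hpre.pair hfst)
  have h1 : Semidec fun P (x : α × ℕ × ℕ) => ∀ c < x.2.2 ^ x.2.1,
      S (pre (join P (boundedDigits (B x.1) x.2.2 c)) x.2.1, x.1) = true :=
    Semidec.forall_lt (R := fun P (x : α × ℕ × ℕ) c =>
      S (pre (join P (boundedDigits (B x.1) x.2.2 c)) x.2.1, x.1) = true)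
      (n := fun x => x.2.2 ^ x.2.1) h0 (by fun_prop)
  have h2 : Semidec fun (_ : ℕ → ℕ) (x : α × ℕ × ℕ) => ∀ i < x.2.1, B x.1 i < x.2.2 := by
    refine Semidec.forall_lt (R := fun _ (x : α × ℕ × ℕ) i => B x.1 i < x.2.2)
      (n := fun x => x.2.1) ?_ (by fun_prop)
    have hBc : Computable fun y : (α × ℕ × ℕ) × ℕ => B y.1.1 y.2 :=
      hB.comp (g := fun y : (α × ℕ × ℕ) × ℕ => (y.1.1, y.2)) (by fun_prop)
    refine (Semidec.of_computable (b := fun y : (α × ℕ × ℕ) × ℕ =>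
      Nat.ble (B y.1.1 y.2 + 1) y.1.2.2) (by fun_prop)).of_iff fun P y => by rw [Nat.ble_eq, Nat.succ_le_iff]
  -- The certificate consists of a stage `t` at which all bounded sequences are accepted and a base
  -- `b` exceeding the first `t` bounds; checking it is a finite task.
  refine (Semidec.exists (R := fun P a (tb : ℕ × ℕ) => (∀ i < tb.1, B a i < tb.2) ∧
    ∀ c < tb.2 ^ tb.1, S (pre (join P (boundedDigits (B a) tb.2 c)) tb.1, a) = true)
    (Semidec.and h2 h1)).of_iff fun P a => ?_
  constructor
  · intro H
    -- `K` is compact by Tychonoff, and acceptance by stage `t` defines an increasing open cover of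
    -- it, so a single stage serves all sequences.
    let K : Set (ℕ → ℕ) := Set.pi Set.univ fun i => Set.Iic (B a i)
    have hK : IsCompact K := isCompact_univ_pi fun i => (Set.finite_Iic _).isCompact
    let O : ℕ → Set (ℕ → ℕ) := fun t => {Q | S (pre (join P Q) t, a) = true}
    have hO : ∀ t, IsOpen (O t) := by
      intro t
      rw [isOpen_iff_mem_nhds]
      intro Q hQ
      refine Filter.mem_of_superset
        ((PiNat.isOpen_cylinder (fun _ : ℕ => ℕ) Q t).mem_nhds (PiNat.self_mem_cylinder Q t)) ?_
      intro Q' hQ'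
      have : pre (join P Q') t = pre (join P Q) t :=
        pre_congr (join_congr fun i hi => hQ' i hi)
      change S (pre (join P Q') t, a) = true
      rw [this]
      exact hQ
    have hcov : K ⊆ ⋃ t, O t := by
      intro Q hQ
      obtain ⟨t, ht⟩ := (hRS _ _).1 (H Q fun i => hQ i (Set.mem_univ i))
      exact Set.mem_iUnion.2 ⟨t, ht⟩
    obtain ⟨t, ht⟩ := hK.elim_directed_cover O hO hcov
      (directed_of_isDirected_le fun m n hmn Q hQ => hmono _ _ _ _ hmn hQ)
    refine ⟨(t, (Finset.range t).sup (B a) + 1), fun i hi => Nat.lt_succ_iff.2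
      (Finset.le_sup (f := B a) (Finset.mem_range.2 hi)), fun c _ => ht ?_⟩
    exact fun i _ => boundedDigits_le _ _ _ _
  · rintro ⟨⟨t, b⟩, hb, h⟩ Q hQ
    obtain ⟨c, hc, hcQ⟩ := exists_boundedDigits (B a) b t hb Q hQ
    have := h c hc
    rw [pre_congr (join_congr hcQ)] at this
    exact (hRS _ _).2 ⟨t, this⟩

/-- A semidecidable relation that holds depends only on a prefix of the second sequence. -/
theorem Semidec.exists_use {R : (ℕ → ℕ) → α → Prop} (hR : Semidec R) {P Q : ℕ → ℕ} {a : α}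
    (h : R (join P Q) a) : ∃ m, ∀ Q', (∀ i < m, Q' i = Q i) → R (join P Q') a := by
  obtain ⟨S, -, hRS⟩ := hR
  obtain ⟨m, hm⟩ := (hRS _ _).1 h
  refine ⟨m, fun Q' hQ' => (hRS _ _).2 ⟨m, ?_⟩⟩
  rwa [pre_congr (join_congr hQ')]

end Semidec

/-! ## Evaluation of associates -/

/-- Evaluation of the associate with graph `G` at the sequence `p`: the digit `n` is `v`. -/
def AssocEval (G : ℕ → ℕ → Prop) (p : ℕ → ℕ) (n v : ℕ) : Prop :=
  ∃ m, G (query p n m) (v + 1) ∧ ∀ m' < m, G (query p n m') 0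

/-- Evaluation is phrased through graphs because a learner's value is itself an associate: the
output graph of one evaluation can be fed to the next, without totality having to be known
beforehand. -/
theorem mem_assocFun {q p r : ℕ → ℕ} :
    r ∈ assocFun q p ↔ ∀ n, AssocEval (fun e v => q e = v) p n (r n) := by
  classical
  constructor
  · rintro ⟨h, rfl⟩ n
    refine ⟨Nat.find (h n), ?_, fun m' hm' => not_not.1 (Nat.find_min (h n) hm')⟩
    have := Nat.find_spec (h n)
    change q _ = q (query p n (Nat.find (h n))) - 1 + 1
    omega
  · intro h
    have hd : ∀ n, ∃ m, q (query p n m) ≠ 0 := fun n => by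
      obtain ⟨m, hm, -⟩ := h n
      exact ⟨m, by omega⟩
    refine ⟨hd, funext fun n => ?_⟩
    obtain ⟨m, hm, hlt⟩ := h n
    have : Nat.find (hd n) = m :=
      (Nat.find_eq_iff _).2 ⟨by omega, fun m' hm' => not_not.2 (hlt m' hm')⟩
    change q (query p n (Nat.find (hd n))) - 1 = r n
    rw [this]
    omega

theorem AssocEval.unique {G : ℕ → ℕ → Prop} (hG : ∀ e v v', G e v → G e v' → v = v')
    {p : ℕ → ℕ} {n v v' : ℕ} (h : AssocEval G p n v) (h' : AssocEval G p n v') : v = v' := by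
  obtain ⟨m, hm, hlt⟩ := h
  obtain ⟨m', hm', hlt'⟩ := h'
  rcases lt_trichotomy m m' with h | rfl | h
  · have := hG _ _ _ hm (hlt' m h)
    omega
  · have := hG _ _ _ hm hm'
    omega
  · have := hG _ _ _ hm' (hlt m' h)
    omega

theorem assocEval_of_mem {q p r : ℕ → ℕ} (hr : r ∈ assocFun q p) (n v : ℕ) :
    AssocEval (fun e v => q e = v) p n v ↔ r n = v := by
  have h := mem_assocFun.1 hr n
  refine ⟨fun h' => AssocEval.unique (fun e v v' h h' => h.symm.trans h') h h', ?_⟩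
  rintro rfl
  exact h

section

variable {α : Type*} [Primcodable α]

theorem relComputable_query {p : (ℕ → ℕ) → α → ℕ → ℕ}
    (hp : RelComputable fun P (x : α × ℕ) => p P x.1 x.2) :
    RelComputable fun P (x : α × ℕ × ℕ) => query (p P x.1) x.2.1 x.2.2 := by
  have h1 : RelComputable fun P (x : α × ℕ × ℕ) => pre (p P x.1) x.2.2 :=
    (relComputable_pre hp).comp_computable (f := fun x : α × ℕ × ℕ => (x.1, x.2.2)) (by fun_prop)
  have h2 : RelComputable fun (_ : ℕ → ℕ) (x : α × ℕ × ℕ) => x.2.1 :=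
    RelComputable.of_computable (by fun_prop)
  exact (h2.pair h1).map Computable.encode

theorem semidec_assocEval {G : (ℕ → ℕ) → α → ℕ → ℕ → Prop}
    (hG : Semidec fun P (x : α × ℕ × ℕ) => G P x.1 x.2.1 x.2.2)
    {p : (ℕ → ℕ) → α → ℕ → ℕ} (hp : RelComputable fun P (x : α × ℕ) => p P x.1 x.2) :
    Semidec fun P (x : α × ℕ × ℕ) => AssocEval (G P x.1) (p P x.1) x.2.1 x.2.2 := by
  have key : ∀ {β : Type _} [Primcodable β] {a : β → α} {n m v : β → ℕ}, Computable a →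
      Computable n → Computable m → Computable v →
      Semidec fun P y => G P (a y) (query (p P (a y)) (n y) (m y)) (v y) := by
    intro β _ a n m v ha hn hm hv
    have h1 : RelComputable fun P y => query (p P (a y)) (n y) (m y) :=
      (relComputable_query hp).comp_computable (f := fun y => (a y, n y, m y)) (by fun_prop)
    exact hG.subst ((RelComputable.of_computable ha).pair
      (h1.pair (RelComputable.of_computable hv)))
  refine Semidec.exists (R := fun P (x : α × ℕ × ℕ) m =>
    G P x.1 (query (p P x.1) x.2.1 m) (x.2.2 + 1) ∧
      ∀ m' < m, G P x.1 (query (p P x.1) x.2.1 m') 0) (Semidec.and ?_ ?_)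
  · exact key (a := fun y : (α × ℕ × ℕ) × ℕ => y.1.1) (by fun_prop) (by fun_prop) (by fun_prop)
      (by fun_prop)
  · exact Semidec.forall_lt (R := fun P (y : (α × ℕ × ℕ) × ℕ) m' =>
      G P y.1.1 (query (p P y.1.1) y.1.2.1 m') 0) (n := fun y => y.2)
      (key (a := fun y : ((α × ℕ × ℕ) × ℕ) × ℕ => y.1.1.1) (by fun_prop) (by fun_prop)
        (by fun_prop) (by fun_prop)) (by fun_prop)

theorem computable_pre {f : α → ℕ → ℕ} (hf : Computable fun x : α × ℕ => f x.1 x.2) {n : α → ℕ}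
    (hn : Computable n) : Computable fun a => pre (f a) (n a) := by
  have h : Computable fun a => Nat.rec (motive := fun _ => List ℕ) []
      (fun m ih => ih ++ [f a m]) (n a) := by
    refine Computable.nat_rec hn (Computable.const [])
      (Computable.to₂ (f := fun p : α × ℕ × List ℕ => p.2.2 ++ [f p.1 p.2.1]) ?_)
    refine Computable.list_concat.comp (by fun_prop) ?_
    exact hf.comp (g := fun p : α × ℕ × List ℕ => (p.1, p.2.1)) (by fun_prop)
  refine h.of_eq fun a => ?_
  induction n a with
  | zero => rfl
  | succ n ih =>
    change _ ++ [f a n] = _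
    rw [ih]
    simp [pre, List.range_succ]

end

/-! ## Comparison of codes of rational numbers -/

/-- The test whether `ratSeq u + 4 * 2 ^ (-n) < ratSeq v`. -/
def ratLt (u v n : ℕ) : Bool :=
  Nat.ble (u.unpair.1.unpair.1 * (v.unpair.2 + 1) * 2 ^ n
      + 4 * (u.unpair.2 + 1) * (v.unpair.2 + 1)
      + v.unpair.1.unpair.2 * (u.unpair.2 + 1) * 2 ^ n + 1)
    (v.unpair.1.unpair.1 * (u.unpair.2 + 1) * 2 ^ n
      + u.unpair.1.unpair.2 * (v.unpair.2 + 1) * 2 ^ n)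

/-- Multiplying by both denominators and by `2 ^ n`, and moving the negative terms across, leaves an
inequality of natural numbers. -/
theorem ratLt_iff (u v n : ℕ) :
    ratLt u v n = true ↔ (ratSeq u : ℝ) + 4 * (1 / 2) ^ n < ratSeq v := by
  rw [ratLt, Nat.ble_eq, Nat.succ_le_iff, ← Nat.cast_lt (α := ℝ)]
  simp only [ratSeq]
  push_cast
  generalize (u.unpair.1.unpair.1 : ℝ) = a
  generalize (u.unpair.1.unpair.2 : ℝ) = b
  generalize (v.unpair.1.unpair.1 : ℝ) = a'
  generalize (v.unpair.1.unpair.2 : ℝ) = b'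
  have hc : (0 : ℝ) < (u.unpair.2 : ℝ) + 1 := by positivity
  have hc' : (0 : ℝ) < (v.unpair.2 : ℝ) + 1 := by positivity
  generalize (u.unpair.2 : ℝ) + 1 = c at *
  generalize (v.unpair.2 : ℝ) + 1 = c' at *
  have ht : (0 : ℝ) < 2 ^ n := by positivity
  rw [one_div, inv_pow]
  generalize (2 : ℝ) ^ n = t at *
  have h : (a' - b') / c' - ((a - b) / c + 4 * t⁻¹) =
      (a' * c * t + b * c' * t - (a * c' * t + 4 * c * c' + b' * c * t)) / (c * c' * t) := by
    field_simp
    ring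
  rw [← sub_pos, ← sub_pos (a := (a' - b') / c'), h]
  constructor
  · intro h
    positivity
  · intro h
    exact (div_pos_iff_of_pos_right (by positivity)).1 h

@[fun_prop]
theorem computable_ratLt {α : Type*} [Primcodable α] {u v n : α → ℕ} (hu : Computable u)
    (hv : Computable v) (hn : Computable n) : Computable fun a => ratLt (u a) (v a) (n a) := by
  unfold ratLt
  fun_prop

/-- A code of the rational number `2 ^ (-n)`. -/
def powCode (n : ℕ) : ℕ := Nat.pair (Nat.pair 1 0) (2 ^ n - 1)

theorem ratSeq_powCode (n : ℕ) : (ratSeq (powCode n) : ℝ) = (1 / 2) ^ n := by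
  simp [ratSeq, powCode]

@[fun_prop]
theorem computable_powCode {α : Type*} [Primcodable α] {n : α → ℕ} (hn : Computable n) :
    Computable fun a => powCode (n a) := by
  unfold powCode
  fun_prop

theorem exists_pow_mul_lt {δ : ℝ} (hδ : 0 < δ) (c : ℝ) (hc : 0 < c) (N : ℕ) :
    ∃ n ≥ N, c * (1 / 2 : ℝ) ^ n < δ := by
  obtain ⟨n, hn⟩ := exists_pow_lt_of_lt_one (div_pos hδ hc) (by norm_num : (1 / 2 : ℝ) < 1)
  refine ⟨max n N, le_max_right _ _, ?_⟩
  have h : (1 / 2 : ℝ) ^ max n N ≤ (1 / 2) ^ n :=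
    pow_le_pow_of_le_one (by norm_num) (by norm_num) (le_max_left _ _)
  have := (lt_div_iff₀ hc).1 (h.trans_lt hn)
  linarith

/-! ## Finite covers of computably compact metric spaces -/

section Cover

variable {X : Type*} [MetricSpace X]

/-- `g` computes the distances of the members of the dense sequence of `M`. -/
def ComputableMetric.IsDist (M : ComputableMetric X) (g : ℕ × ℕ × ℕ → ℕ) : Prop :=
  ∀ i j n, |(ratSeq (g (i, j, n)) : ℝ) - dist (M.pt i) (M.pt j)| ≤ (1 / 2 : ℝ) ^ n

variable {M : ComputableMetric X} {g : ℕ × ℕ × ℕ → ℕ}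

/-- The points of the union of the balls with centers `M.pt j.unpair.1` and radii
`2 ^ (-j.unpair.2)`, where `j` is good. -/
def ComputableMetric.Covered (M : ComputableMetric X) (good : ℕ → Bool) (x : X) : Prop :=
  ∃ j, good j = true ∧ dist (M.pt j.unpair.1) x < (1 / 2 : ℝ) ^ j.unpair.2

/-- The test, with precision `i`, whether the point with index `z` is in a good ball. -/
def coverTest (g : ℕ × ℕ × ℕ → ℕ) (good : ℕ → Bool) (z i : ℕ) : Bool :=
  anyLt (fun j => good j && ratLt (g (j.unpair.1, z, i)) (powCode j.unpair.2) i) (i + 1)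

/-- At precision `i` the computed distance to the center errs by at most `2 * 2 ^ (-i)`, which the
margin `4 * 2 ^ (-i)` of `ratLt` absorbs. -/
theorem exists_coverTest_iff (hg : M.IsDist g) (good : ℕ → Bool) {p : ℕ → ℕ} {x : X}
    (hp : M.naming.IsName p x) :
    (∃ i, coverTest g good (p i) i = true) ↔ M.Covered good x := by
  have hp : ∀ n, dist (M.pt (p n)) x ≤ (1 / 2 : ℝ) ^ n := hp
  simp only [coverTest, anyLt_iff, Bool.and_eq_true, ratLt_iff, ratSeq_powCode]
  constructor
  · rintro ⟨i, j, -, hj, h⟩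
    refine ⟨j, hj, ?_⟩
    have h1 := abs_le.1 (hg j.unpair.1 (p i) i)
    have h2 := dist_triangle (M.pt j.unpair.1) (M.pt (p i)) x
    have h3 := hp i
    have : (0 : ℝ) < (1 / 2) ^ i := by positivity
    linarith
  · rintro ⟨j, hj, h⟩
    -- The constant is the error 2 plus the margin 4; `i ≥ j` puts the ball `j` within the search
    -- bound of `coverTest`.
    obtain ⟨i, hi, h6⟩ := exists_pow_mul_lt (sub_pos.2 h) 6 (by norm_num) j
    refine ⟨i, j, by omega, hj, ?_⟩
    have h1 := abs_le.1 (hg j.unpair.1 (p i) i)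
    have h2 := dist_triangle_right (M.pt j.unpair.1) (M.pt (p i)) x
    have h3 := hp i
    linarith

/-- An associate of the characteristic function of the union of the good balls. -/
def coverAssoc (g : ℕ × ℕ × ℕ → ℕ) (good : ℕ → Bool) (e : ℕ) : ℕ :=
  ((Encodable.decode e.unpair.2 : Option (List ℕ)).bind fun w =>
    w[e.unpair.1]?.map fun z => bif coverTest g good z e.unpair.1 then 2 else 1).getD 0

theorem coverAssoc_query_of_lt (good : ℕ → Bool) (p : ℕ → ℕ) {i m : ℕ} (h : i < m) :
    coverAssoc g good (query p i m) = bif coverTest g good (p i) i then 2 else 1 := by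
  have h1 : (pre p m)[i]? = some (p i) := (getElem?_pre _ _ _ _).2 ⟨h, rfl⟩
  simp [coverAssoc, query, h1]

theorem coverAssoc_query_of_le (good : ℕ → Bool) (p : ℕ → ℕ) {i m : ℕ} (h : m ≤ i) :
    coverAssoc g good (query p i m) = 0 := by
  have h1 : (pre p m)[i]? = none := List.getElem?_eq_none (by rwa [length_pre])
  simp [coverAssoc, query, h1]

theorem coverAssoc_mem (good : ℕ → Bool) (p : ℕ → ℕ) :
    (fun i => bif coverTest g good (p i) i then 1 else 0) ∈ assocFun (coverAssoc g good) p := by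
  refine mem_assocFun.2 fun i => ⟨i + 1, ?_, fun m hm => ?_⟩
  · change coverAssoc g good _ = _
    rw [coverAssoc_query_of_lt _ _ (Nat.lt_succ_self i)]
    cases coverTest g good (p i) i <;> rfl
  · exact coverAssoc_query_of_le _ _ (by omega)

theorem isName_sierpinski_coverTest (hg : M.IsDist g) (good : ℕ → Bool) {p : ℕ → ℕ} {x : X}
    (hp : M.naming.IsName p x) :
    sierpinski.IsName (fun i => bif coverTest g good (p i) i then 1 else 0) (M.Covered good x) := by
  change _ ↔ ∃ n, _
  rw [← exists_coverTest_iff hg good hp]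
  refine exists_congr fun i => ?_
  cases h : coverTest g good (p i) i <;> simp [h]

theorem isContinuous_covered (hg : M.IsDist g) (good : ℕ → Bool) :
    IsContinuous M.naming sierpinski (M.Covered good) := by
  refine ⟨((fun p i => bif coverTest g good (p i) i then 1 else 0 :
    (ℕ → ℕ) → (ℕ → ℕ)) : (ℕ → ℕ) →. (ℕ → ℕ)), ?_, fun p x hp => ?_⟩
  · refine continuous_pi fun i => ?_
    exact (continuous_of_discreteTopology
      (f := fun z : ℕ => bif coverTest g good z i then 1 else 0)).comp
      ((continuous_apply i).comp continuous_subtype_val)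
  · exact ⟨_, Part.mem_some _, isName_sierpinski_coverTest hg good hp⟩

/-- The union of the good balls, as an open set. -/
def ComputableMetric.coverMap (M : ComputableMetric X) (hg : M.IsDist g) (good : ℕ → Bool) :
    ContMap M.naming sierpinski :=
  ⟨M.Covered good, isContinuous_covered hg good⟩

theorem isName_coverMap (hg : M.IsDist g) (good : ℕ → Bool) :
    (M.naming.fn sierpinski).IsName (coverAssoc g good) (M.coverMap hg good) :=
  fun p _ hp => ⟨_, coverAssoc_mem good p, isName_sierpinski_coverTest hg good hp⟩

/-- The associate `q` recognizes that `P` is a name of the whole space, at the digit `n` and after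
reading `m` digits. -/
def Recognizes (q P : ℕ → ℕ) (n m : ℕ) : Prop :=
  2 ≤ q (query P n m) ∧ ∀ m' < m, q (query P n m') = 0

theorem exists_recognizes {q : ℕ → ℕ}
    (hq : IsRealizer (M.naming.fn sierpinski) sierpinski (assocFun q) (isFull M.naming))
    {P : ℕ → ℕ} {U : ContMap M.naming sierpinski} (hP : (M.naming.fn sierpinski).IsName P U) :
    (∃ n m, Recognizes q P n m) ↔ ∀ x, U x := by
  obtain ⟨r, hr, hrU⟩ := hq P U hP
  have hrU : (∀ x, U x) ↔ ∃ n, r n ≠ 0 := hrU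
  rw [hrU]
  constructor
  · rintro ⟨n, m, h2, h0⟩
    refine ⟨n, ?_⟩
    have h : AssocEval (fun e v => q e = v) P n (q (query P n m) - 1) :=
      ⟨m, show _ = _ by omega, h0⟩
    rw [(assocEval_of_mem hr _ _).1 h]
    omega
  · rintro ⟨n, hn⟩
    obtain ⟨m, hm, h0⟩ := mem_assocFun.1 hr n
    exact ⟨n, m, by omega, h0⟩

/-- A recognition reads only the first `m` digits of the name of the cover, and these involve only
balls with index below `m`. Discarding all other balls leaves the prefix unchanged, so `q`
recognizes the truncated union as well, and this must then be the whole space. -/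
theorem Recognizes.covered {q : ℕ → ℕ} (hg : M.IsDist g)
    (hq : IsRealizer (M.naming.fn sierpinski) sierpinski (assocFun q) (isFull M.naming))
    {good : ℕ → Bool} {n m : ℕ} (h : Recognizes q (coverAssoc g good) n m) (x : X) :
    ∃ j < m, good j = true ∧ dist (M.pt j.unpair.1) x < (1 / 2 : ℝ) ^ j.unpair.2 := by
  let good' : ℕ → Bool := fun j => good j && decide (j < m)
  have hag : ∀ e < m, coverAssoc g good' e = coverAssoc g good e := by
    intro e he
    have hi : e.unpair.1 < m := (Nat.unpair_left_le e).trans_lt he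
    have ht : ∀ z, coverTest g good' z e.unpair.1 = coverTest g good z e.unpair.1 := by
      intro z
      rw [Bool.eq_iff_iff, coverTest, coverTest, anyLt_iff, anyLt_iff]
      refine exists_congr fun j => and_congr_right fun hj => ?_
      have : decide (j < m) = true := decide_eq_true (by omega)
      simp [good', this]
    simp only [coverAssoc, ht]
  have hpre : ∀ m' ≤ m, query (coverAssoc g good') n m' = query (coverAssoc g good) n m' := by
    intro m' hm'
    rw [query, query, pre_congr fun i hi => hag i (by omega)]
  have h' : Recognizes q (coverAssoc g good') n m := by
    refine ⟨by rw [hpre m le_rfl]; exact h.1, fun m' hm' => ?_⟩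
    rw [hpre m' hm'.le]
    exact h.2 m' hm'
  obtain ⟨j, hj, hx⟩ := (exists_recognizes hq (isName_coverMap hg good')).1 ⟨n, m, h'⟩ x
  simp only [good', Bool.and_eq_true, decide_eq_true_eq] at hj
  exact ⟨j, hj.2, hj.1, hx⟩

theorem exists_finite_cover (hg : M.IsDist g) (hM : ComputablyCompact M.naming)
    {good : ℕ → Bool} (h : ∀ x, M.Covered good x) :
    ∃ m, ∀ x, ∃ j < m, good j = true ∧ dist (M.pt j.unpair.1) x < (1 / 2 : ℝ) ^ j.unpair.2 := by
  obtain ⟨q, -, hq⟩ := hM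
  obtain ⟨n, m, hr⟩ := (exists_recognizes hq (isName_coverMap hg good)).2 h
  exact ⟨m, hr.covered hg hq⟩

theorem computable_coverAssoc {α : Type*} [Primcodable α] (hg : Computable g) {good : α → ℕ → Bool}
    (hgood : Computable fun x : α × ℕ => good x.1 x.2) :
    Computable fun x : α × ℕ => coverAssoc g (good x.1) x.2 := by
  have ht : Computable fun y : ((α × ℕ) × List ℕ) × ℕ =>
      coverTest g (good y.1.1.1) y.2 y.1.1.2.unpair.1 := by
    refine computable_anyLt (f := fun (y : ((α × ℕ) × List ℕ) × ℕ) j =>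
      good y.1.1.1 j && ratLt (g (j.unpair.1, y.2, y.1.1.2.unpair.1)) (powCode j.unpair.2)
        y.1.1.2.unpair.1) (computable_bool_and ?_ (by fun_prop)) (by fun_prop)
    exact hgood.comp (g := fun z : (((α × ℕ) × List ℕ) × ℕ) × ℕ => (z.1.1.1.1, z.2))
      (by fun_prop)
  refine computable_getD (Computable.option_bind (by fun_prop) (Computable.to₂
    (f := fun y : (α × ℕ) × List ℕ => y.2[y.1.2.unpair.1]?.map fun z =>
      bif coverTest g (good y.1.1) z y.1.2.unpair.1 then 2 else 1) ?_)) (by fun_prop)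
  refine Computable.option_map (by fun_prop) (Computable.to₂
    (f := fun y : ((α × ℕ) × List ℕ) × ℕ =>
      bif coverTest g (good y.1.1.1) y.2 y.1.1.2.unpair.1 then 2 else 1) ?_)
  fun_prop

/-- A computably compact computable metric space is computably totally bounded. -/
theorem exists_computable_cover (hg : Computable g) (hgM : M.IsDist g)
    (hM : ComputablyCompact M.naming) :
    ∃ J : ℕ → ℕ, Computable J ∧ ∀ n x, ∃ j ≤ J n, dist (M.pt j) x ≤ (1 / 2 : ℝ) ^ n := by
  obtain ⟨q, hqc, hq⟩ := hM
  let good : ℕ → ℕ → Bool := fun n j => decide (j.unpair.2 = n)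
  have hfull : ∀ n x, M.Covered (good n) x := by
    intro n x
    obtain ⟨i, hi⟩ := M.dense.exists_dist_lt x (by positivity : (0 : ℝ) < (1 / 2 : ℝ) ^ n)
    exact ⟨Nat.pair i n, by simp [good], by simpa [dist_comm] using hi⟩
  let val : ℕ → ℕ → ℕ → ℕ := fun n i m => q (query (coverAssoc g (good n)) i m)
  have hval : Computable fun x : ℕ × ℕ × ℕ => val x.1 x.2.1 x.2.2 := by
    refine hqc.comp (Computable.encode.comp (Computable.pair (by fun_prop) ?_))
    refine computable_pre (f := fun (x : ℕ × ℕ × ℕ) e => coverAssoc g (good x.1) e) ?_ (by fun_prop)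
    exact (computable_coverAssoc hg (good := good) (by fun_prop)).comp
      (g := fun y : (ℕ × ℕ × ℕ) × ℕ => (y.1.1, y.2)) (by fun_prop)
  -- `s` codes a digit and a prefix length at which the balls of radius `2 ^ (-n)` are recognized as
  -- a cover. The search for `s` succeeds by density, and the prefix length then bounds the indices
  -- of the centers needed.
  let b : ℕ → ℕ → Bool := fun n s => Nat.ble 2 (val n s.unpair.1 s.unpair.2) &&
    !anyLt (fun m => Nat.ble 1 (val n s.unpair.1 m)) s.unpair.2
  have hb : ∀ n s, b n s = true ↔
      Recognizes q (coverAssoc g (good n)) s.unpair.1 s.unpair.2 := by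
    intro n s
    simp only [b, Bool.and_eq_true, Nat.ble_eq, Bool.not_eq_true', ← Bool.not_eq_true, anyLt_iff,
      Recognizes, val]
    simp
  obtain ⟨f, hf, hfb⟩ := exists_computable_find (b := b) (by
      refine computable_bool_and ?_ (computable_bool_not (computable_anyLt
        (f := fun (x : ℕ × ℕ) m => Nat.ble 1 (val x.1 x.2.unpair.1 m))
        (n := fun x : ℕ × ℕ => x.2.unpair.2) ?_ (by fun_prop)))
      · exact computable_ble (by fun_prop) (hval.comp
          (g := fun x : ℕ × ℕ => (x.1, x.2.unpair.1, x.2.unpair.2)) (by fun_prop))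
      · exact computable_ble (by fun_prop) (hval.comp
          (g := fun x : (ℕ × ℕ) × ℕ => (x.1.1, x.1.2.unpair.1, x.2)) (by fun_prop))) fun n => by
    obtain ⟨i, m, h⟩ := (exists_recognizes hq (isName_coverMap hgM (good n))).2 (hfull n)
    exact ⟨Nat.pair i m, (hb _ _).2 (by simpa using h)⟩
  refine ⟨fun n => (f n).unpair.2, by fun_prop, fun n x => ?_⟩
  obtain ⟨j, hj, hgj, hd⟩ := ((hb _ _).1 (hfb n)).covered hgM hq x
  have hjn : j.unpair.2 = n := of_decide_eq_true hgj
  rw [hjn] at hd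
  exact ⟨j.unpair.1, (Nat.unpair_left_le j).trans hj.le, hd.le⟩

/-- Rapid Cauchy sequences in a computably compact computable metric space converge. -/
theorem exists_isName_of_dist_le (hg : M.IsDist g) (hM : ComputablyCompact M.naming) {p : ℕ → ℕ}
    (hp : ∀ a b, dist (M.pt (p a)) (M.pt (p b)) ≤ (1 / 2 : ℝ) ^ a + 5 * (1 / 2 : ℝ) ^ b) :
    ∃ x, M.naming.IsName p x := by
  classical
  -- A cluster point suffices: along indices `b` tending to infinity the term `5 * 2 ^ (-b)`
  -- disappears, which leaves exactly the speed required of a name.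
  suffices h : ∃ x, ∀ r > 0, ∀ N, ∃ b ≥ N, dist (M.pt (p b)) x < r by
    obtain ⟨x, hx⟩ := h
    refine ⟨x, fun a => ?_⟩
    refine le_of_forall_pos_le_add fun δ hδ => ?_
    obtain ⟨N, -, hN⟩ := exists_pow_mul_lt (half_pos hδ) 5 (by norm_num) 0
    obtain ⟨b, hb, hbx⟩ := hx (δ / 2) (half_pos hδ) N
    have h1 : (1 / 2 : ℝ) ^ b ≤ (1 / 2) ^ N :=
      pow_le_pow_of_le_one (by norm_num) (by norm_num) hb
    have h2 := hp a b
    have h3 := dist_triangle (M.pt (p a)) (M.pt (p b)) x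
    linarith
  by_contra hno
  push Not at hno
  -- The good balls are those that the sequence eventually avoids. Without a cluster point they
  -- cover the space, and beyond the last of the thresholds of a finite subcover the sequence would
  -- have nowhere to go. `good` need not be computable, since `q` acts on arbitrary names.
  let good : ℕ → Bool := fun j =>
    decide (∃ N, ∀ b ≥ N, (1 / 2 : ℝ) ^ j.unpair.2 ≤ dist (M.pt j.unpair.1) (M.pt (p b)))
  obtain ⟨m, hm⟩ := exists_finite_cover hg hM (good := good) fun x => by
    obtain ⟨r, hr, N, hN⟩ := hno x
    obtain ⟨n, -, hn⟩ := exists_pow_mul_lt hr 2 (by norm_num) 0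
    obtain ⟨i, hi⟩ := M.dense.exists_dist_lt x (by positivity : (0 : ℝ) < (1 / 2 : ℝ) ^ n)
    rw [dist_comm] at hi
    refine ⟨Nat.pair i n, decide_eq_true ⟨N, fun b hb => ?_⟩, by simpa using hi⟩
    have h1 := hN b hb
    have h2 := dist_triangle_left (M.pt (p b)) x (M.pt i)
    rw [Nat.unpair_pair]
    linarith
  have hf : ∀ j, ∃ N, good j = true →
      ∀ b ≥ N, (1 / 2 : ℝ) ^ j.unpair.2 ≤ dist (M.pt j.unpair.1) (M.pt (p b)) := by
    intro j
    by_cases h : good j = true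
    · obtain ⟨N, hN⟩ := of_decide_eq_true h
      exact ⟨N, fun _ => hN⟩
    · exact ⟨0, fun h' => absurd h' h⟩
  choose f hf using hf
  obtain ⟨j, hj, hgj, hd⟩ := hm (M.pt (p ((Finset.range m).sup f)))
  exact absurd hd (not_lt.2 (hf j hgj _ (Finset.le_sup (Finset.mem_range.2 hj))))

end Cover

/-! ## Names of training data -/

/-- The name of a list of length `len` that consists of names `idx i` and labels `lab i`. -/
def mkName (len : ℕ) (idx : ℕ → ℕ → ℕ) (lab : ℕ → ℕ) (e : ℕ) : ℕ :=
  bif decide (e = 0) then len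
  else bif decide ((e - 1).unpair.2 % 2 = 0) then
    idx (e - 1).unpair.1 ((e - 1).unpair.2 / 2)
  else lab (e - 1).unpair.1

theorem mkName_idx (len : ℕ) (idx : ℕ → ℕ → ℕ) (lab : ℕ → ℕ) (i n : ℕ) :
    mkName len idx lab (Nat.pair i (2 * n) + 1) = idx i n := by
  simp [mkName]

theorem mkName_lab (len : ℕ) (idx : ℕ → ℕ → ℕ) (lab : ℕ → ℕ) (i : ℕ) :
    mkName len idx lab (Nat.pair i 1 + 1) = lab i := by
  simp [mkName]

/-- A name of the concatenation of two lists, computed from their names. -/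
def catName (p Q : ℕ → ℕ) (e : ℕ) : ℕ :=
  bif decide (e = 0) then p 0 + Q 0
  else bif Nat.ble (p 0) (e - 1).unpair.1 then
    Q (Nat.pair ((e - 1).unpair.1 - p 0) (e - 1).unpair.2 + 1)
  else p e

section

variable {X : Type*} [MetricSpace X] {M : ComputableMetric X} {k : ℕ}

theorem dataNaming_isName_iff {p : ℕ → ℕ} {l : List (X × Fin k)} :
    (dataNaming M.naming k).IsName p l ↔ p 0 = l.length ∧ ∀ (i : ℕ) (hi : i < l.length),
      M.naming.IsName (fun n => p (Nat.pair i (2 * n) + 1)) l[i].1 ∧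
        p (Nat.pair i 1 + 1) = l[i].2 :=
  Iff.rfl

theorem isName_mkName {idx : ℕ → ℕ → ℕ} {lab : ℕ → ℕ} {l : List (X × Fin k)}
    (h : ∀ (i : ℕ) (hi : i < l.length), M.naming.IsName (idx i) l[i].1 ∧ lab i = l[i].2) :
    (dataNaming M.naming k).IsName (mkName l.length idx lab) l := by
  refine dataNaming_isName_iff.2 ⟨rfl, fun i hi => ?_⟩
  simp only [mkName_idx, mkName_lab]
  exact h i hi

theorem isName_catName {Y : Type*} {A : Naming Y} {p Q : ℕ → ℕ} {l l' : List Y} (hp : A.list.IsName p l)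
    (hQ : A.list.IsName Q l') : A.list.IsName (catName p Q) (l ++ l') := by
  obtain ⟨hp0, hp⟩ := hp
  obtain ⟨hQ0, hQ⟩ := hQ
  refine ⟨by simp [catName, hp0, hQ0], fun i hi => ?_⟩
  by_cases hil : i < l.length
  · have h : (fun m => catName p Q (Nat.pair i m + 1)) = fun m => p (Nat.pair i m + 1) := by
      funext m
      have : Nat.ble (p 0) i = false := by
        rw [← Bool.not_eq_true, Nat.ble_eq]
        omega
      simp [catName, this]
    rw [h, List.getElem_append_left hil]
    exact hp i hil
  · have h : (fun m => catName p Q (Nat.pair i m + 1)) =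
        fun m => Q (Nat.pair (i - l.length) m + 1) := by
      funext m
      have : Nat.ble (p 0) i = true := by
        rw [Nat.ble_eq]
        omega
      rw [hp0] at this
      simp [catName, this, hp0]
    rw [List.length_append] at hi
    rw [h, List.getElem_append_right (by omega)]
    exact hQ _ (by omega)

/-! ## Labels -/

/-- The sequence with graph `E` is a name of the label `l`. -/
def IsLabelGraph (E : ℕ → ℕ → Prop) (l : ℕ) : Prop :=
  ∃ m, (∀ i < m, E i 0) ∧ (∀ i < l + 1, E (m + i) 1) ∧ E (m + l + 1) 0

/-- The zeros in front fix the start of the block of ones and the zero behind it fixes its length,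
so finitely many digits determine the label. -/
theorem isLabelGraph_iff {r : ℕ → ℕ} {y : WithBot (Fin k)} (hr : (labelNaming k).IsName r y)
    (l : ℕ) : IsLabelGraph (fun n v => r n = v) l ↔ ∃ h : l < k, y = ((⟨l, h⟩ : Fin k) : _) := by
  constructor
  · rintro ⟨m, h0, h1, h2⟩
    replace h0 : ∀ i < m, r i = 0 := h0
    replace h1 : ∀ i < l + 1, r (m + i) = 1 := h1
    replace h2 : r (m + l + 1) = 0 := h2
    rcases hr with ⟨-, hr⟩ | ⟨l', rfl, m', hr⟩
    · have := h1 0 (by omega)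
      rw [hr] at this
      omega
    · have hm : m = m' := by
        have e1 := h1 0 (by omega)
        rw [hr] at e1
        have e2 : ¬ m' < m := fun h => by
          have := h0 m' h
          rw [hr, if_pos (by omega)] at this
          omega
        split_ifs at e1
        omega
      have hl : l = l' := by
        have e1 := h1 l (by omega)
        rw [hr] at e1 h2
        split_ifs at e1 h2
        omega
      subst hl
      exact ⟨l'.2, rfl⟩
  · rintro ⟨h, rfl⟩
    rcases hr with ⟨hr, -⟩ | ⟨l', hl, m, hr⟩
    · exact absurd hr (WithBot.coe_ne_bot)
    · have hl : l = l' := congrArg Fin.val (WithBot.coe_injective hl)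
      refine ⟨m, fun i hi => ?_, fun i hi => ?_, ?_⟩
      · change r i = 0
        rw [hr, if_neg (by omega)]
      · change r (m + i) = 1
        rw [hr, if_pos (by omega)]
      · change r (m + l + 1) = 0
        rw [hr, if_neg (by omega)]

/-- The learner with name `q`, trained with the data with name `p`, assigns the label `l` to the
point with name `x`. -/
def LabelEval (q p x : ℕ → ℕ) (l : ℕ) : Prop :=
  IsLabelGraph (AssocEval (AssocEval (fun e v => q e = v) p) x) l

/-- The name of the learner is evaluated at the data, and the resulting associate at the point; on
genuine names both graphs are those of total sequences. -/
theorem labelEval_iff {X : Type*} {A : Naming X} {L : Learner A k} {q p px : ℕ → ℕ}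
    {data : List (X × Fin k)} {x : X} (hq : (learnerNaming A k).IsName q L)
    (hp : (dataNaming A k).IsName p data) (hx : A.IsName px x) (l : ℕ) :
    LabelEval q p px l ↔ ∃ h : l < k, L data x = ((⟨l, h⟩ : Fin k) : WithBot (Fin k)) := by
  obtain ⟨r₁, hr₁, hn₁⟩ := hq p data hp
  obtain ⟨r₂, hr₂, hn₂⟩ := hn₁ px x hx
  have h1 : AssocEval (fun e v => q e = v) p = fun e v => r₁ e = v := by
    ext e v
    exact assocEval_of_mem hr₁ e v
  have h2 : AssocEval (fun e v => r₁ e = v) px = fun e v => r₂ e = v := by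
    ext e v
    exact assocEval_of_mem hr₂ e v
  rw [LabelEval, h1, h2]
  exact isLabelGraph_iff hn₂ l

section

variable {α : Type*} [Primcodable α]

theorem semidec_labelEval {q p x : (ℕ → ℕ) → α → ℕ → ℕ} {l : α → ℕ}
    (hq : RelComputable fun P (y : α × ℕ) => q P y.1 y.2)
    (hp : RelComputable fun P (y : α × ℕ) => p P y.1 y.2)
    (hx : RelComputable fun P (y : α × ℕ) => x P y.1 y.2) (hl : Computable l) :
    Semidec fun P a => LabelEval (q P a) (p P a) (x P a) (l a) := by
  have h0 : Semidec fun P (y : α × ℕ × ℕ) => q P y.1 y.2.1 = y.2.2 :=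
    Semidec.comp hq (f := fun y : α × ℕ × ℕ => ((y.1, y.2.1), y.2.2)) (by fun_prop)
  have h1 := semidec_assocEval (G := fun P a e v => q P a e = v) h0 hp
  have h2 := semidec_assocEval (G := fun P a => AssocEval (fun e v => q P a e = v) (p P a)) h1 hx
  refine Semidec.exists (R := fun P a m =>
    (∀ i < m, AssocEval (AssocEval (fun e v => q P a e = v) (p P a)) (x P a) i 0) ∧
    (∀ i < l a + 1, AssocEval (AssocEval (fun e v => q P a e = v) (p P a)) (x P a) (m + i) 1) ∧
    AssocEval (AssocEval (fun e v => q P a e = v) (p P a)) (x P a) (m + l a + 1) 0)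
    (Semidec.and ?_ (Semidec.and ?_ ?_))
  · refine Semidec.forall_lt (R := fun P (y : α × ℕ) i =>
      AssocEval (AssocEval (fun e v => q P y.1 e = v) (p P y.1)) (x P y.1) i 0)
      (n := fun y => y.2) ?_ (by fun_prop)
    exact h2.comp (f := fun z : (α × ℕ) × ℕ => (z.1.1, z.2, 0)) (by fun_prop)
  · refine Semidec.forall_lt (R := fun P (y : α × ℕ) i =>
      AssocEval (AssocEval (fun e v => q P y.1 e = v) (p P y.1)) (x P y.1) (y.2 + i) 1)
      (n := fun y => l y.1 + 1) ?_ (by fun_prop)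
    exact h2.comp (f := fun z : (α × ℕ) × ℕ => (z.1.1, z.1.2 + z.2, 1)) (by fun_prop)
  · exact h2.comp (f := fun y : α × ℕ => (y.1, y.2 + l y.1 + 1, 0)) (by fun_prop)

end

/-! ## Comparison of distances -/

/-- The approximate distance is off by at most `3 * 2 ^ (-n)` and `ε` by `2 ^ (-n)`, which together
is the margin of `ratLt`. Conversely a gap above `8 * 2 ^ (-n)` covers the errors and the margin. -/
theorem exists_ratLt_dist_iff {g : ℕ × ℕ × ℕ → ℕ} (hg : M.IsDist g) {p q e : ℕ → ℕ} {y x : X}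
    {ε : ℝ} (hp : M.naming.IsName p y) (hq : M.naming.IsName q x) (he : realNaming.IsName e ε) :
    ((∃ n, ratLt (g (p n, q n, n)) (e n) n = true) ↔ dist y x < ε) ∧
      ((∃ n, ratLt (e n) (g (p n, q n, n)) n = true) ↔ ε < dist y x) := by
  have key : ∀ n, |(ratSeq (g (p n, q n, n)) : ℝ) - dist y x| ≤ 3 * (1 / 2 : ℝ) ^ n := by
    intro n
    have h1 := hg (p n) (q n) n
    have h2 : dist (M.pt (p n)) y ≤ (1 / 2 : ℝ) ^ n := hp n
    have h3 : dist (M.pt (q n)) x ≤ (1 / 2 : ℝ) ^ n := hq n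
    have h4 := dist_dist_dist_le (M.pt (p n)) (M.pt (q n)) y x
    rw [Real.dist_eq] at h4
    have h5 := abs_sub_le (ratSeq (g (p n, q n, n)) : ℝ) (dist (M.pt (p n)) (M.pt (q n)))
      (dist y x)
    linarith
  have he' : ∀ n, |(ratSeq (e n) : ℝ) - ε| ≤ (1 / 2 : ℝ) ^ n := by
    intro n
    have := he n
    rwa [Real.dist_eq] at this
  simp only [ratLt_iff]
  refine ⟨⟨?_, fun h => ?_⟩, ⟨?_, fun h => ?_⟩⟩
  · rintro ⟨n, hn⟩
    have h1 := abs_le.1 (key n)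
    have h2 := abs_le.1 (he' n)
    linarith
  · obtain ⟨n, -, hn⟩ := exists_pow_mul_lt (sub_pos.2 h) 8 (by norm_num) 0
    have h1 := abs_le.1 (key n)
    have h2 := abs_le.1 (he' n)
    exact ⟨n, by linarith⟩
  · rintro ⟨n, hn⟩
    have h1 := abs_le.1 (key n)
    have h2 := abs_le.1 (he' n)
    linarith
  · obtain ⟨n, -, hn⟩ := exists_pow_mul_lt (sub_pos.2 h) 8 (by norm_num) 0
    have h1 := abs_le.1 (key n)
    have h2 := abs_le.1 (he' n)
    exact ⟨n, by linarith⟩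

/-! ## A compact set of names of training data -/

/-- The sequence `Q` is refuted as a name of training data. -/
def RefutedName (g : ℕ × ℕ × ℕ → ℕ) (k : ℕ) (Q : ℕ → ℕ) : Prop :=
  ∃ i, i < Q 0 ∧ (k ≤ Q (Nat.pair i 1 + 1) ∨ ∃ a b, ratLt (powCode a)
    (g (Q (Nat.pair i (2 * a) + 1), Q (Nat.pair i (2 * b) + 1), b)) b = true)

/-- Entries `a` and `b` of a name are at most `2 ^ (-a) + 2 ^ (-b)` apart; the error of `g` adds
another `2 ^ (-b)`, still below the threshold. -/
theorem not_refutedName {g : ℕ × ℕ × ℕ → ℕ} (hg : M.IsDist g) {Q : ℕ → ℕ}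
    {l : List (X × Fin k)} (hQ : (dataNaming M.naming k).IsName Q l) : ¬ RefutedName g k Q := by
  obtain ⟨h0, h⟩ := dataNaming_isName_iff.1 hQ
  rintro ⟨i, hi, hk | ⟨a, b, hab⟩⟩
  · have := (h i (by omega)).2
    have := l[i].2.2
    omega
  · have hn := (h i (by omega)).1
    have ha := hn a
    have hb := hn b
    rw [ratLt_iff, ratSeq_powCode] at hab
    have h1 := abs_le.1 (hg (Q (Nat.pair i (2 * a) + 1)) (Q (Nat.pair i (2 * b) + 1)) b)
    have h2 := dist_triangle_right (M.pt (Q (Nat.pair i (2 * a) + 1)))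
      (M.pt (Q (Nat.pair i (2 * b) + 1))) (l[i]'(by omega)).1
    have : (0 : ℝ) < (1 / 2) ^ b := by positivity
    linarith

/-- Unrefuted entries `a` and `b` are within `2 ^ (-a) + 5 * 2 ^ (-b)`: margin 4 plus the error of
`g`. The slack sits on `b` only, so it vanishes in the limit. -/
theorem exists_isName_of_not_refutedName {g : ℕ × ℕ × ℕ → ℕ} (hg : M.IsDist g)
    (hM : ComputablyCompact M.naming) {Q : ℕ → ℕ} (hQ : ¬ RefutedName g k Q) :
    ∃ l : List (X × Fin k), (dataNaming M.naming k).IsName Q l := by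
  simp only [RefutedName, not_exists, not_and, not_or] at hQ
  have hx : ∀ i : Fin (Q 0), ∃ x, M.naming.IsName (fun n => Q (Nat.pair i (2 * n) + 1)) x := by
    intro i
    refine exists_isName_of_dist_le hg hM fun a b => ?_
    have h := (hQ i i.2).2 a b
    rw [ratLt_iff, ratSeq_powCode, not_lt] at h
    have h1 := abs_le.1 (hg (Q (Nat.pair i (2 * a) + 1)) (Q (Nat.pair i (2 * b) + 1)) b)
    linarith
  choose x hx using hx
  have hlab : ∀ i : Fin (Q 0), Q (Nat.pair i 1 + 1) < k := fun i => not_le.1 (hQ i i.2).1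
  refine ⟨List.ofFn fun i => (x i, ⟨_, hlab i⟩), dataNaming_isName_iff.2 ⟨by simp, ?_⟩⟩
  intro i hi
  have hi' : i < Q 0 := by simpa using hi
  rw [List.getElem_ofFn]
  exact ⟨hx ⟨i, hi'⟩, rfl⟩

/-- A bound for some name of every list of training data of length at most `N`. -/
def nameBound (J : ℕ → ℕ) (k N e : ℕ) : ℕ :=
  bif decide (e = 0) then N else max (J ((e - 1).unpair.2 / 2)) k

/-- One bounded name per list is enough, since the learner's answer does not depend on the name.
Entries beyond the list default to `0`, which respects every bound. -/
theorem exists_isName_le_nameBound {J : ℕ → ℕ}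
    (hJ : ∀ n x, ∃ j ≤ J n, dist (M.pt j) x ≤ (1 / 2 : ℝ) ^ n) {N : ℕ} {l : List (X × Fin k)}
    (hl : l.length ≤ N) :
    ∃ Q, (dataNaming M.naming k).IsName Q l ∧ ∀ e, Q e ≤ nameBound J k N e := by
  choose j hj hd using hJ
  refine ⟨mkName l.length (fun i n => (l[i]?.map fun y : X × Fin k => j n y.1).getD 0)
    (fun i => (l[i]?.map fun y : X × Fin k => (y.2 : ℕ)).getD 0),
    isName_mkName fun i hi => ⟨fun n => ?_, ?_⟩, fun e => ?_⟩
  · simp only [List.getElem?_eq_getElem hi, Option.map_some, Option.getD_some]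
    exact hd n _
  · simp only [List.getElem?_eq_getElem hi, Option.map_some, Option.getD_some]
  · by_cases he : e = 0
    · simpa [mkName, nameBound, he] using hl
    · have h1 : ∀ i n : ℕ, (l[i]?.map fun y : X × Fin k => j n y.1).getD 0 ≤ J n := by
        intro i n
        cases l[i]? with
        | none => exact Nat.zero_le _
        | some y => exact hj n y.1
      have h2 : ∀ i : ℕ, (l[i]?.map fun y : X × Fin k => (y.2 : ℕ)).getD 0 ≤ k := by
        intro i
        cases l[i]? with
        | none => exact Nat.zero_le _
        | some y => exact y.2.2.le
      simp only [mkName, nameBound, he, decide_false, cond_false]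
      cases decide ((e - 1).unpair.2 % 2 = 0)
      · exact (h2 _).trans (le_max_right _ _)
      · exact (h1 _ _).trans (le_max_left _ _)

theorem computable_nameBound {J : ℕ → ℕ} (hJ : Computable J) (k : ℕ) {α : Type*} [Primcodable α]
    {N e : α → ℕ} (hN : Computable N) (he : Computable e) :
    Computable fun a => nameBound J k (N a) (e a) := by
  unfold nameBound
  fun_prop

/-! ## Dense points as training data -/

/-- The standard name of a list of labelled members of the dense sequence. -/
def ptName (a : List (ℕ × ℕ)) : ℕ → ℕ :=
  mkName a.length (fun i _ => (a[i]?.map Prod.fst).getD 0)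
    (fun i => (a[i]?.map Prod.snd).getD 0)

theorem computable_ptName : Computable fun x : List (ℕ × ℕ) × ℕ => ptName x.1 x.2 := by
  have h : ∀ {f : ℕ × ℕ → ℕ}, Computable f → Computable fun x : List (ℕ × ℕ) × ℕ =>
      (x.1[(x.2 - 1).unpair.1]?.map f).getD 0 := by
    intro f hf
    refine computable_getD (Computable.option_map (by fun_prop)
      (Computable.to₂ (f := fun y : (List (ℕ × ℕ) × ℕ) × (ℕ × ℕ) => f y.2) ?_)) (by fun_prop)
    fun_prop
  have h1 := h Computable.fst
  have h2 := h Computable.snd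
  unfold ptName mkName
  fun_prop

theorem isName_ptName (a : List (ℕ × Fin k)) :
    (dataNaming M.naming k).IsName (ptName (a.map fun y => (y.1, (y.2 : ℕ))))
      (a.map fun y => (M.pt y.1, y.2)) := by
  have h := isName_mkName (M := M) (l := a.map fun y => (M.pt y.1, y.2))
    (idx := fun i _ => ((a.map fun y => (y.1, (y.2 : ℕ)))[i]?.map Prod.fst).getD 0)
    (lab := fun i => ((a.map fun y => (y.1, (y.2 : ℕ)))[i]?.map Prod.snd).getD 0) ?_
  · simpa only [ptName, List.length_map] using h
  · intro i hi
    have hi' : i < a.length := by simpa using hi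
    refine ⟨fun n => ?_, ?_⟩
    · simp [hi']
    · simp [hi']

theorem exists_isName_ptName (a : List (ℕ × ℕ)) (ha : ∀ i < a.length,
      ptName a (Nat.pair i 1 + 1) < k) :
    ∃ l : List (X × Fin k), (dataNaming M.naming k).IsName (ptName a) l := by
  have h : ∀ y ∈ a, y.2 < k := by
    intro y hy
    obtain ⟨i, hi, rfl⟩ := List.getElem_of_mem hy
    simpa [ptName, mkName_lab, hi] using ha i hi
  have e : (a.pmap (fun (y : ℕ × ℕ) (hy : y.2 < k) => (y.1, (⟨y.2, hy⟩ : Fin k))) h).map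
      (fun y => (y.1, (y.2 : ℕ))) = a := by
    simp [List.map_pmap]
  have := isName_ptName (M := M)
    (a.pmap (fun (y : ℕ × ℕ) (hy : y.2 < k) => (y.1, (⟨y.2, hy⟩ : Fin k))) h)
  rw [e] at this
  exact ⟨_, this⟩

/-- Every list of training data has a name all of whose prefixes extend to names of lists of
members of the dense sequence. -/
theorem exists_isName_forall_prefix (l : List (X × Fin k)) :
    ∃ Q, (dataNaming M.naming k).IsName Q l ∧ ∀ m, ∃ (Q' : ℕ → ℕ) (a : List (ℕ × ℕ))
      (l' : List (X × Fin k)), (∀ i < m, Q' i = Q i) ∧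
        (dataNaming M.naming k).IsName Q' l' ∧ (dataNaming M.naming k).IsName (ptName a) l' := by
  -- Twice the required precision leaves room to freeze the sequence: for `n < m` the approximations
  -- `n` and `m` are at most `2 ^ (-n)` apart.
  have hpt : ∀ (n : ℕ) (x : X), ∃ j, dist (M.pt j) x ≤ (1 / 2 : ℝ) ^ (n + 1) := by
    intro n x
    obtain ⟨j, hj⟩ := M.dense.exists_dist_lt x (by positivity : (0 : ℝ) < (1 / 2 : ℝ) ^ (n + 1))
    exact ⟨j, by rw [dist_comm]; exact hj.le⟩
  choose j hj using hpt
  let idx : ℕ → ℕ → ℕ := fun i n => (l[i]?.map fun y => j n y.1).getD 0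
  let lab : ℕ → ℕ := fun i => (l[i]?.map fun y => (y.2 : ℕ)).getD 0
  have hidx : ∀ i (hi : i < l.length) n, idx i n = j n l[i].1 := by
    intro i hi n
    simp [idx, hi]
  have hlab : ∀ i (hi : i < l.length), lab i = l[i].2 := by
    intro i hi
    simp [lab, hi]
  refine ⟨mkName l.length idx lab, isName_mkName fun i hi => ⟨fun n => ?_, hlab i hi⟩, fun m => ?_⟩
  · rw [hidx i hi]
    refine (hj n _).trans ?_
    exact pow_le_pow_of_le_one (by norm_num) (by norm_num) (Nat.le_succ n)
  · let b : List (ℕ × Fin k) := l.map fun y => (j m y.1, y.2)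
    -- Freezing at index `m` turns each point into a member of the dense sequence; digits at
    -- positions below `m` only involve indices below `m`.
    let idx' : ℕ → ℕ → ℕ := fun i n => if n < m then idx i n else idx i m
    have hlen : (b.map fun y => (M.pt y.1, y.2)).length = l.length := by simp [b]
    refine ⟨mkName (b.map fun y => (M.pt y.1, y.2)).length idx' lab, _, _, ?_,
      isName_mkName fun i hi => ?_, isName_ptName b⟩
    · intro e he
      rw [hlen]
      have h2 := Nat.unpair_right_le (e - 1)
      by_cases he0 : e = 0
      · simp [mkName, he0]
      · have hlt : (e - 1).unpair.2 / 2 < m := by omega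
        simp [mkName, idx', hlt]
    · have hi' : i < l.length := by rwa [hlen] at hi
      have hb : (b.map fun y => (M.pt y.1, y.2))[i] = (M.pt (j m l[i].1), l[i].2) := by
        simp [b]
      rw [hb]
      refine ⟨fun n => ?_, hlab i hi'⟩
      change dist (M.pt (if n < m then idx i n else idx i m)) _ ≤ _
      rw [hidx i hi', hidx i hi']
      split_ifs with hn
      · have h1 := dist_triangle_right (M.pt (j n l[i].1)) (M.pt (j m l[i].1)) l[i].1
        have h2 := hj n l[i].1
        have h3 := hj m l[i].1
        have h4 : (1 / 2 : ℝ) ^ (m + 1) ≤ (1 / 2) ^ (n + 1) :=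
          pow_le_pow_of_le_one (by norm_num) (by norm_num) (by omega)
        have h5 : (1 / 2 : ℝ) ^ (n + 1) = (1 / 2) ^ n / 2 := by rw [pow_succ]; ring
        linarith
      · rw [dist_self]
        positivity

end

/-! ## Semidecidability of sparseness and denseness -/

/-- The name of the learner in a name of `(L, N, ε, data, x)`. -/
def learnerPart (P : ℕ → ℕ) (n : ℕ) : ℕ := P (2 * n)

/-- The number `N` in a name of `(L, N, ε, data, x)`. -/
def boundPart (P : ℕ → ℕ) : ℕ := P (2 * (2 * 0) + 1)

/-- The name of `ε` in a name of `(L, N, ε, data, x)`. -/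
def radiusPart (P : ℕ → ℕ) (n : ℕ) : ℕ := P (2 * (2 * (2 * n) + 1) + 1)

/-- The name of the training data in a name of `(L, N, ε, data, x)`. -/
def dataPart (P : ℕ → ℕ) (n : ℕ) : ℕ := P (2 * (2 * (2 * (2 * n) + 1) + 1) + 1)

/-- The name of the point in a name of `(L, N, ε, data, x)`. -/
def pointPart (P : ℕ → ℕ) (n : ℕ) : ℕ := P (2 * (2 * (2 * (2 * n + 1) + 1) + 1) + 1)

/-- The label given to the point of `P` after training with the data of `P`, extended by the data
with name `Q`, is `l`. -/
def ExtLabel (P Q : ℕ → ℕ) (l : ℕ) : Prop :=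
  LabelEval (learnerPart P) (catName (dataPart P) Q) (pointPart P) l

/-- `Q` is an admissible extension, with at most `N` points at distance greater than `ε`, that leads
to the label `l`. -/
def FarExtension (g : ℕ × ℕ × ℕ → ℕ) (k : ℕ) (P Q : ℕ → ℕ) (l : ℕ) : Prop :=
  Nat.ble (Q 0) (boundPart P) = true ∧
    (∀ i < Q 0, Nat.ble (Q (Nat.pair i 1 + 1) + 1) k = true ∧ ∃ n, ratLt (radiusPart P n)
      (g (Q (Nat.pair i (2 * n) + 1), pointPart P n, n)) n = true) ∧
    ExtLabel P Q l

/-- Some point of the data with name `Q` has distance less than `ε`. -/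
def HasNear (g : ℕ × ℕ × ℕ → ℕ) (P Q : ℕ → ℕ) : Prop :=
  ∃ i, i < Q 0 ∧ ∃ n, ratLt (g (Q (Nat.pair i (2 * n) + 1), pointPart P n, n))
    (radiusPart P n) n = true

section Semidec

variable {α : Type*} [Primcodable α] {g : ℕ × ℕ × ℕ → ℕ}

theorem relComputable_eval {f : α → ℕ} (hf : Computable f) : RelComputable fun P a => P (f a) :=
  relComputable_apply (RelComputable.of_computable hf)

theorem RelComputable.pair₃ {Φ₁ Φ₂ Φ₃ : (ℕ → ℕ) → α → ℕ} (h₁ : RelComputable Φ₁)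
    (h₂ : RelComputable Φ₂) (h₃ : RelComputable Φ₃) :
    RelComputable fun P a => (Φ₁ P a, Φ₂ P a, Φ₃ P a) :=
  h₁.pair (h₂.pair h₃)

theorem semidec_ratLt {u v n : (ℕ → ℕ) → α → ℕ} (hu : RelComputable u) (hv : RelComputable v)
    (hn : RelComputable n) : Semidec fun P a => ratLt (u P a) (v P a) (n P a) = true := by
  have h : Computable fun x : ℕ × ℕ × ℕ => ratLt x.1 x.2.1 x.2.2 := by fun_prop
  exact Semidec.subst (R := fun _ (x : ℕ × ℕ × ℕ) => ratLt x.1 x.2.1 x.2.2 = true)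
    (Φ := fun P a => (u P a, v P a, n P a)) (Semidec.of_computable h) (hu.pair₃ hv hn)

theorem semidec_ble {u v : (ℕ → ℕ) → α → ℕ} (hu : RelComputable u) (hv : RelComputable v) :
    Semidec fun P a => Nat.ble (u P a) (v P a) = true :=
  (Semidec.of_computable (b := fun x : ℕ × ℕ => Nat.ble x.1 x.2) (by fun_prop)).subst (hu.pair hv)

theorem relComputable_catName {p Q : (ℕ → ℕ) → ℕ → ℕ}
    (hp : RelComputable fun P (n : ℕ) => p P n) (hQ : RelComputable fun P (n : ℕ) => Q P n)
    {f : α → ℕ} (hf : Computable f) : RelComputable fun P a => catName (p P) (Q P) (f a) := by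
  have h0 : RelComputable fun P (a : α) => p P 0 :=
    hp.comp_computable (f := fun _ => 0) (by fun_prop)
  have h1 : RelComputable fun P (a : α) => Q P 0 :=
    hQ.comp_computable (f := fun _ => 0) (by fun_prop)
  refine relComputable_cond (RelComputable.of_computable (by fun_prop)) ?_
    (relComputable_cond ?_ ?_ ?_)
  · exact (h0.pair h1).map (f := fun x : ℕ × ℕ => x.1 + x.2) (by fun_prop)
  · exact (h0.pair (RelComputable.of_computable (f := fun a => f a) hf)).map
      (f := fun x : ℕ × ℕ => Nat.ble x.1 (x.2 - 1).unpair.1) (by fun_prop)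
  · refine RelComputable.comp (Φ := fun P n => Q P n) hQ ?_
    exact (h0.pair (RelComputable.of_computable (f := fun a => f a) hf)).map
      (f := fun x : ℕ × ℕ => Nat.pair ((x.2 - 1).unpair.1 - x.1) (x.2 - 1).unpair.2 + 1)
      (by fun_prop)
  · exact hp.comp_computable (f := fun a => f a) hf

theorem semidec_extLabel {l : α → ℕ} (hl : Computable l) :
    Semidec fun Z a => ExtLabel (fun n => Z (2 * n)) (fun n => Z (2 * n + 1)) (l a) := by
  unfold ExtLabel learnerPart dataPart pointPart
  refine semidec_labelEval (q := fun Z _ n => Z (2 * (2 * n)))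
    (p := fun Z _ => catName (fun n => Z (2 * (2 * (2 * (2 * (2 * n) + 1) + 1) + 1)))
      fun n => Z (2 * n + 1))
    (x := fun Z _ n => Z (2 * (2 * (2 * (2 * (2 * n + 1) + 1) + 1) + 1))) ?_ ?_ ?_ hl
  · exact relComputable_eval (by fun_prop)
  · exact relComputable_catName (relComputable_eval (by fun_prop))
      (relComputable_eval (by fun_prop)) (by fun_prop)
  · exact relComputable_eval (by fun_prop)

theorem semidec_farExtension (hg : Computable g) (k : ℕ) :
    Semidec fun Z l => FarExtension g k (fun n => Z (2 * n)) (fun n => Z (2 * n + 1)) l := by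
  refine Semidec.and ?_ (Semidec.and ?_ (semidec_extLabel (by fun_prop)))
  · exact semidec_ble (relComputable_eval (by fun_prop)) (relComputable_eval (by fun_prop))
  · refine Semidec.forall_lt_rel (α := ℕ) (n := fun Z (_ : ℕ) => Z (2 * 0 + 1))
      (R := fun Z (_ : ℕ) i => Nat.ble (Z (2 * (Nat.pair i 1 + 1) + 1) + 1) k = true ∧
        ∃ n, ratLt (radiusPart (fun n => Z (2 * n)) n) (g (Z (2 * (Nat.pair i (2 * n) + 1) + 1),
          pointPart (fun n => Z (2 * n)) n, n)) n = true) (Semidec.and ?_ ?_)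
      (relComputable_eval (by fun_prop))
    · refine semidec_ble (RelComputable.map (f := fun n : ℕ => n + 1)
        (relComputable_eval (by fun_prop)) (by fun_prop))
        (RelComputable.of_computable (by fun_prop))
    · refine Semidec.exists_nat (R := fun Z (x : ℕ × ℕ) n => ratLt
        (radiusPart (fun n => Z (2 * n)) n) (g (Z (2 * (Nat.pair x.2 (2 * n) + 1) + 1),
          pointPart (fun n => Z (2 * n)) n, n)) n = true) (semidec_ratLt ?_ ?_ ?_)
      · exact relComputable_eval (by fun_prop)
      · exact (RelComputable.pair₃ (relComputable_eval (by fun_prop))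
          (relComputable_eval (by fun_prop))
          (RelComputable.of_computable (by fun_prop))).map hg
      · exact RelComputable.of_computable (by fun_prop)

theorem semidec_hasNear (hg : Computable g) :
    Semidec fun Z (_ : α) => HasNear g (fun n => Z (2 * n)) (fun n => Z (2 * n + 1)) := by
  refine Semidec.exists_nat (R := fun Z (_ : α) i => i < Z (2 * 0 + 1) ∧ ∃ n, ratLt
    (g (Z (2 * (Nat.pair i (2 * n) + 1) + 1), pointPart (fun n => Z (2 * n)) n, n))
      (radiusPart (fun n => Z (2 * n)) n) n = true) (Semidec.and ?_ ?_)
  · refine Semidec.of_iff (semidec_ble (u := fun _ (x : α × ℕ) => x.2 + 1)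
      (v := fun Z _ => Z (2 * 0 + 1)) (RelComputable.of_computable (by fun_prop))
      (relComputable_eval (by fun_prop))) fun Z x => ?_
    rw [Nat.ble_eq, Nat.succ_le_iff]
  · refine Semidec.exists_nat (R := fun Z (x : α × ℕ) n => ratLt
      (g (Z (2 * (Nat.pair x.2 (2 * n) + 1) + 1), pointPart (fun n => Z (2 * n)) n, n))
      (radiusPart (fun n => Z (2 * n)) n) n = true) (semidec_ratLt ?_ ?_ ?_)
    · exact (RelComputable.pair₃ (relComputable_eval (by fun_prop))
        (relComputable_eval (by fun_prop)) (RelComputable.of_computable (by fun_prop))).map hg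
    · exact relComputable_eval (by fun_prop)
    · exact RelComputable.of_computable (by fun_prop)

theorem semidec_refutedName (hg : Computable g) (k : ℕ) :
    Semidec fun Z (_ : α) => RefutedName g k fun n => Z (2 * n + 1) := by
  refine Semidec.exists_nat (R := fun Z (_ : α) i => i < Z (2 * 0 + 1) ∧
    (k ≤ Z (2 * (Nat.pair i 1 + 1) + 1) ∨ ∃ a b, ratLt (powCode a)
      (g (Z (2 * (Nat.pair i (2 * a) + 1) + 1), Z (2 * (Nat.pair i (2 * b) + 1) + 1), b)) b = true))
    (Semidec.and ?_ (Semidec.or ?_ ?_))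
  · refine Semidec.of_iff (semidec_ble (u := fun _ (x : α × ℕ) => x.2 + 1)
      (v := fun Z _ => Z (2 * 0 + 1)) (RelComputable.of_computable (by fun_prop))
      (relComputable_eval (by fun_prop))) fun Z x => ?_
    rw [Nat.ble_eq, Nat.succ_le_iff]
  · refine Semidec.of_iff (semidec_ble (u := fun _ (_ : α × ℕ) => k)
      (v := fun Z x => Z (2 * (Nat.pair x.2 1 + 1) + 1)) (RelComputable.of_computable (by fun_prop))
      (relComputable_eval (by fun_prop))) fun Z x => ?_
    rw [Nat.ble_eq]
  · refine Semidec.exists_nat (R := fun Z (x : α × ℕ) a => ∃ b, ratLt (powCode a)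
      (g (Z (2 * (Nat.pair x.2 (2 * a) + 1) + 1), Z (2 * (Nat.pair x.2 (2 * b) + 1) + 1), b)) b
        = true) ?_
    refine Semidec.exists_nat (R := fun Z (x : (α × ℕ) × ℕ) b => ratLt (powCode x.2)
      (g (Z (2 * (Nat.pair x.1.2 (2 * x.2) + 1) + 1), Z (2 * (Nat.pair x.1.2 (2 * b) + 1) + 1), b))
        b = true) (semidec_ratLt ?_ ?_ ?_)
    · exact RelComputable.of_computable (by fun_prop)
    · exact (RelComputable.pair₃ (relComputable_eval (by fun_prop))
        (relComputable_eval (by fun_prop)) (RelComputable.of_computable (by fun_prop))).map hg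
    · exact RelComputable.of_computable (by fun_prop)

/-- Lists of pairs of numbers form a countable type and `ptName` is computable, so this is an
unbounded search after substituting `ptName` for the second half of the oracle. -/
theorem semidec_exists_farExtension (hg : Computable g) (k : ℕ) :
    Semidec fun P (_ : Unit) => ∃ (y z : List (ℕ × ℕ) × ℕ),
      FarExtension g k P (ptName y.1) y.2 ∧ FarExtension g k P (ptName z.1) z.2 ∧ y.2 ≠ z.2 := by
  have h : Semidec fun P (y : List (ℕ × ℕ) × ℕ) => FarExtension g k P (ptName y.1) y.2 := by
    have := ((semidec_farExtension hg k).comp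
      (f := fun y : List (ℕ × ℕ) × ℕ => y.2) (by fun_prop)).subst_oracle
      (Φ := fun P y => join P (ptName y.1))
        (relComputable_join (Q := fun _ (y : List (ℕ × ℕ) × ℕ) => ptName y.1)
        (RelComputable.of_computable (computable_ptName.comp
          (g := fun x : (List (ℕ × ℕ) × ℕ) × ℕ => (x.1.1, x.2)) (by fun_prop))))
    simpa only [join_even, join_odd] using this
  refine Semidec.exists (R := fun P (_ : Unit) (y : List (ℕ × ℕ) × ℕ) =>
    ∃ z : List (ℕ × ℕ) × ℕ, FarExtension g k P (ptName y.1) y.2 ∧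
      FarExtension g k P (ptName z.1) z.2 ∧ y.2 ≠ z.2) ?_
  refine Semidec.exists (R := fun P (x : Unit × List (ℕ × ℕ) × ℕ) (z : List (ℕ × ℕ) × ℕ) =>
    FarExtension g k P (ptName x.2.1) x.2.2 ∧
      FarExtension g k P (ptName z.1) z.2 ∧ x.2.2 ≠ z.2) (Semidec.and ?_ (Semidec.and ?_ ?_))
  · exact h.comp (f := fun x : (Unit × List (ℕ × ℕ) × ℕ) × List (ℕ × ℕ) × ℕ => x.1.2)
      (by fun_prop)
  · exact h.comp (f := fun x : (Unit × List (ℕ × ℕ) × ℕ) × List (ℕ × ℕ) × ℕ => x.2)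
      (by fun_prop)
  · refine (Semidec.of_computable (b := fun x : (Unit × List (ℕ × ℕ) × ℕ) × List (ℕ × ℕ) × ℕ =>
      !decide (x.1.2.2 = x.2.2)) (by fun_prop)).of_iff fun P x => ?_
    simp

/-- `Semidec.forall_le` wants a bound computable from its parameter alone, whereas `N` is read from
the oracle. Hence `N` is first made a parameter, next to `l`, and afterwards replaced by `boundPart
P`. -/
theorem semidec_forall_label {J : ℕ → ℕ} (hg : Computable g) (hJ : Computable J) (k : ℕ) :
    Semidec fun P (_ : Unit) => ∃ l, ∀ Q : ℕ → ℕ, (∀ e, Q e ≤ nameBound J k (boundPart P) e) →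
      RefutedName g k Q ∨ HasNear g P Q ∨ ExtLabel P Q l := by
  have h := Semidec.forall_le (α := ℕ × ℕ) (R := fun Z a => RefutedName g k (fun n => Z (2 * n + 1)) ∨
    HasNear g (fun n => Z (2 * n)) (fun n => Z (2 * n + 1)) ∨
    ExtLabel (fun n => Z (2 * n)) (fun n => Z (2 * n + 1)) a.1)
    ((semidec_refutedName hg k).or ((semidec_hasNear hg).or (semidec_extLabel (by fun_prop))))
    (B := fun a e => nameBound J k a.2 e) (computable_nameBound hJ k (by fun_prop) (by fun_prop))
  simp only [join_even, join_odd] at h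
  refine Semidec.exists_nat (R := fun P (_ : Unit) l => ∀ Q : ℕ → ℕ,
    (∀ e, Q e ≤ nameBound J k (boundPart P) e) →
      RefutedName g k Q ∨ HasNear g P Q ∨ ExtLabel P Q l) ?_
  exact h.subst (Φ := fun P (x : Unit × ℕ) => (x.2, boundPart P))
    ((RelComputable.of_computable (by fun_prop)).pair (relComputable_eval (by fun_prop)))

end Semidec

/-! ## Correctness -/

section Correct

variable {X : Type*} [MetricSpace X] {M : ComputableMetric X} {k : ℕ} {g : ℕ × ℕ × ℕ → ℕ}
  {P : ℕ → ℕ} {L : Learner M.naming k} {N : ℕ} {ε : {ε : ℝ // 0 < ε}} {data : List (X × Fin k)}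
  {x : X}

/-- The representation of the inputs `(L, N, ε, data, x)`. -/
def inputNaming (M : ComputableMetric X) (k : ℕ) :
    Naming (Learner M.naming k × ℕ × {ε : ℝ // 0 < ε} × List (X × Fin k) × X) :=
  (learnerNaming M.naming k).prod (natNaming.prod
    ((realNaming.subtype fun ε => 0 < ε).prod ((dataNaming M.naming k).prod M.naming)))

theorem inputNaming_isName_iff : (inputNaming M k).IsName P (L, N, ε, data, x) ↔
    (learnerNaming M.naming k).IsName (learnerPart P) L ∧ boundPart P = N ∧
      realNaming.IsName (radiusPart P) ε ∧ (dataNaming M.naming k).IsName (dataPart P) data ∧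
      M.naming.IsName (pointPart P) x :=
  Iff.rfl

/-- The right side does not mention `Q`: all names of one list give the same answer, which later
permits exchanging names. -/
theorem extLabel_iff (hP : (inputNaming M k).IsName P (L, N, ε, data, x)) {Q : ℕ → ℕ}
    {a : List (X × Fin k)} (hQ : (dataNaming M.naming k).IsName Q a) (l : ℕ) :
    ExtLabel P Q l ↔ ∃ h : l < k, L (data ++ a) x = ((⟨l, h⟩ : Fin k) : WithBot (Fin k)) := by
  obtain ⟨hL, -, -, hd, hx⟩ := inputNaming_isName_iff.1 hP
  exact labelEval_iff hL (isName_catName hd hQ) hx l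

theorem farExtension_iff (hg : M.IsDist g) (hP : (inputNaming M k).IsName P (L, N, ε, data, x))
    {Q : ℕ → ℕ} {a : List (X × Fin k)} (hQ : (dataNaming M.naming k).IsName Q a) (l : ℕ) :
    FarExtension g k P Q l ↔ a.length ≤ N ∧ (∀ y ∈ a, (ε : ℝ) < dist y.1 x) ∧
      ∃ h : l < k, L (data ++ a) x = ((⟨l, h⟩ : Fin k) : WithBot (Fin k)) := by
  obtain ⟨-, hN, hε, -, hx⟩ := inputNaming_isName_iff.1 hP
  obtain ⟨h0, h⟩ := dataNaming_isName_iff.1 hQ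
  rw [FarExtension, extLabel_iff hP hQ, Nat.ble_eq, hN, h0]
  refine and_congr_right fun _ => and_congr_left fun _ => ?_
  rw [List.forall_mem_iff_forall_getElem]
  refine forall_congr' fun i => forall_congr' fun hi => ?_
  rw [(exists_ratLt_dist_iff hg (h i hi).1 hx hε).2, Nat.ble_eq, (h i hi).2]
  exact and_iff_right a[i].2.2

theorem hasNear_iff (hg : M.IsDist g) (hP : (inputNaming M k).IsName P (L, N, ε, data, x))
    {Q : ℕ → ℕ} {a : List (X × Fin k)} (hQ : (dataNaming M.naming k).IsName Q a) :
    HasNear g P Q ↔ ∃ y ∈ a, dist y.1 x < ε := by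
  obtain ⟨-, hN, hε, -, hx⟩ := inputNaming_isName_iff.1 hP
  obtain ⟨h0, h⟩ := dataNaming_isName_iff.1 hQ
  rw [HasNear, h0, List.exists_mem_iff_exists_getElem]
  refine exists_congr fun i => ?_
  constructor
  · rintro ⟨hi, hn⟩
    exact ⟨hi, (exists_ratLt_dist_iff hg (h i hi).1 hx hε).1.1 hn⟩
  · rintro ⟨hi, hn⟩
    exact ⟨hi, (exists_ratLt_dist_iff hg (h i hi).1 hx hε).1.2 hn⟩

theorem exists_eq_coe_of_ne_bot {y : WithBot (Fin k)} (h : y ≠ ⊥) :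
    ∃ (l : ℕ) (hl : l < k), y = ((⟨l, hl⟩ : Fin k) : WithBot (Fin k)) := by
  obtain ⟨l, rfl⟩ := WithBot.ne_bot_iff_exists.1 h
  exact ⟨l, l.2, rfl⟩

theorem sparseAt_iff (hgc : Computable g) (hg : M.IsDist g)
    (hP : (inputNaming M k).IsName P (L, N, ε, data, x)) :
    SparseAt L N ε data x ↔ ∃ (y z : List (ℕ × ℕ) × ℕ),
      FarExtension g k P (ptName y.1) y.2 ∧ FarExtension g k P (ptName z.1) z.2 ∧ y.2 ≠ z.2 := by
  constructor
  · rintro ⟨a, b, haN, hbN, ha, hb, hLa, hab, hLb⟩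
    have key : ∀ c : List (X × Fin k), c.length ≤ N → (∀ y ∈ c, (ε : ℝ) < dist y.1 x) →
        ∀ (l : ℕ) (hl : l < k), L (data ++ c) x = ((⟨l, hl⟩ : Fin k) : WithBot (Fin k)) →
        ∃ c' : List (ℕ × ℕ), FarExtension g k P (ptName c') l := by
      intro c hcN hc l hl hlc
      obtain ⟨Q, hQ, hpre⟩ := exists_isName_forall_prefix (M := M) c
      have hf : FarExtension g k P Q l := (farExtension_iff hg hP hQ l).2 ⟨hcN, hc, hl, hlc⟩
      have hf' : FarExtension g k (fun n => join P Q (2 * n)) (fun n => join P Q (2 * n + 1)) l := by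
        simpa only [join_even, join_odd] using hf
      -- Only `m` digits of `Q` matter, so `Q` may be replaced by `Q'`, which names a list of dense
      -- points, and then by the standard name `ptName c'` of that list.
      obtain ⟨m, hm⟩ := (semidec_farExtension hgc k).exists_use hf'
      obtain ⟨Q', c', c'', hQQ', hQ', hc'⟩ := hpre m
      have h := hm Q' hQQ'
      simp only [join_even, join_odd] at h
      exact ⟨c', (farExtension_iff hg hP hc' l).2 ((farExtension_iff hg hP hQ' l).1 h)⟩
    obtain ⟨l, hl, hla⟩ := exists_eq_coe_of_ne_bot hLa
    obtain ⟨l', hl', hlb⟩ := exists_eq_coe_of_ne_bot hLb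
    obtain ⟨a', ha'⟩ := key a haN ha l hl hla
    obtain ⟨b', hb'⟩ := key b hbN hb l' hl' hlb
    refine ⟨(a', l), (b', l'), ha', hb', ?_⟩
    rintro rfl
    exact hab (hla.trans hlb.symm)
  · rintro ⟨⟨a, l⟩, ⟨b, l'⟩, ha, hb, hll⟩
    have key : ∀ (c : List (ℕ × ℕ)) (l : ℕ), FarExtension g k P (ptName c) l →
        ∃ c' : List (X × Fin k), (dataNaming M.naming k).IsName (ptName c) c' := by
      intro c l h
      refine exists_isName_ptName c fun i hi => ?_
      have := (h.2.1 i hi).1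
      rwa [Nat.ble_eq, Nat.succ_le_iff] at this
    obtain ⟨a', ha'⟩ := key a l ha
    obtain ⟨b', hb'⟩ := key b l' hb
    obtain ⟨haN, had, hl, hla⟩ := (farExtension_iff hg hP ha' l).1 ha
    obtain ⟨hbN, hbd, hl', hlb⟩ := (farExtension_iff hg hP hb' l').1 hb
    refine ⟨a', b', haN, hbN, had, hbd, ?_, ?_, ?_⟩
    · rw [hla]
      exact WithBot.coe_ne_bot
    · rw [hla, hlb]
      exact fun h => hll (congrArg Fin.val (WithBot.coe_injective h))
    · rw [hlb]
      exact WithBot.coe_ne_bot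

theorem denseAt_iff (hg : M.IsDist g) (hM : ComputablyCompact M.naming) {J : ℕ → ℕ}
    (hJ : ∀ n x, ∃ j ≤ J n, dist (M.pt j) x ≤ (1 / 2 : ℝ) ^ n)
    (hP : (inputNaming M k).IsName P (L, N, ε, data, x)) :
    DenseAt L N ε data x ↔
      ∃ l, ∀ Q : ℕ → ℕ, (∀ e, Q e ≤ nameBound J k (boundPart P) e) →
        RefutedName g k Q ∨ HasNear g P Q ∨ ExtLabel P Q l := by
  obtain ⟨-, hN, -⟩ := inputNaming_isName_iff.1 hP
  rw [hN]
  constructor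
  · intro h
    -- The empty extension is always admissible and supplies the common label.
    obtain ⟨l, hl, hlab⟩ := exists_eq_coe_of_ne_bot
      (h [] [] (Nat.zero_le _) (Nat.zero_le _) (by simp) (by simp)).2
    refine ⟨l, fun Q hQ => ?_⟩
    by_cases hr : RefutedName g k Q
    · exact Or.inl hr
    obtain ⟨a, ha⟩ := exists_isName_of_not_refutedName hg hM hr
    refine Or.inr ?_
    by_cases hn : HasNear g P Q
    · exact Or.inl hn
    refine Or.inr ((extLabel_iff hP ha l).2 ⟨hl, ?_⟩)
    rw [hasNear_iff hg hP ha] at hn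
    push Not at hn
    have haN : a.length ≤ N := by
      have := hQ 0
      rw [(dataNaming_isName_iff.1 ha).1] at this
      simpa [nameBound] using this
    rw [← hlab]
    exact (h a [] haN (Nat.zero_le _) hn (by simp)).1
  · rintro ⟨l, h⟩
    have key : ∀ a : List (X × Fin k), a.length ≤ N → (∀ y ∈ a, (ε : ℝ) ≤ dist y.1 x) →
        ∃ hl : l < k, L (data ++ a) x = ((⟨l, hl⟩ : Fin k) : WithBot (Fin k)) := by
      intro a haN ha
      obtain ⟨Q, hQ, hQB⟩ := exists_isName_le_nameBound hJ haN
      rcases h Q hQB with h | h | h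
      · exact absurd h (not_refutedName hg hQ)
      · obtain ⟨y, hy, hyx⟩ := (hasNear_iff hg hP hQ).1 h
        exact absurd hyx (not_lt.2 (ha y hy))
      · exact (extLabel_iff hP hQ l).1 h
    intro a b haN hbN ha hb
    obtain ⟨hl, hla⟩ := key a haN ha
    obtain ⟨_, hlb⟩ := key b hbN hb
    exact ⟨hla.trans hlb.symm, hla ▸ WithBot.coe_ne_bot⟩

end Correct

/-! ## Maps that are defined by two semidecidable cases -/

/-- A map to `2_⊥` is computable if the preimages of both labels are semidecidable. -/
theorem isComputable_of_semidec {Y : Type*} {A : Naming Y} {f : Y → WithBot (Fin 2)}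
    {R₀ R₁ : (ℕ → ℕ) → Unit → Prop} (h₀ : Semidec R₀) (h₁ : Semidec R₁)
    (H₀ : ∀ P z, A.IsName P z → (f z = ((0 : Fin 2) : WithBot (Fin 2)) ↔ R₀ P ()))
    (H₁ : ∀ P z, A.IsName P z → (f z = ((1 : Fin 2) : WithBot (Fin 2)) ↔ R₁ P ())) :
    IsComputable A (labelNaming 2) f := by
  classical
  obtain ⟨S₀, hS₀, hR₀⟩ := h₀
  obtain ⟨S₁, hS₁, hR₁⟩ := h₁
  let T : List ℕ → ℕ → Bool := fun w t => S₀ (w.take t, ()) || S₁ (w.take t, ())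
  -- `F` marks the first stage at which either recognizer accepts. `D` puts a one there, and a
  -- second one just after it if `S₁` was among the accepting recognizers: the names of the labels 0
  -- and 1.
  let F : List ℕ → ℕ → Bool := fun w t => T w t && !anyLt (T w) t
  let D : List ℕ → ℕ → Bool := fun w n =>
    F w n || (Nat.ble 1 n && (F w (n - 1) && S₁ (w.take (n - 1), ())))
  let W : ℕ → List ℕ := fun e => (Encodable.decode e.unpair.2 : Option (List ℕ)).getD []
  -- Digit `n` is withheld until `n` digits of the input are read, and then depends on those `n`
  -- only.
  let q : ℕ → ℕ := fun e => bif Nat.ble e.unpair.1 (W e).length then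
    bif D (W e) e.unpair.1 then 2 else 1 else 0
  have hT : Computable fun x : List ℕ × ℕ => T x.1 x.2 := by fun_prop
  have hF : Computable fun x : List ℕ × ℕ => F x.1 x.2 := by
    refine computable_bool_and hT (computable_bool_not (computable_anyLt
      (f := fun (x : List ℕ × ℕ) t => T x.1 t) ?_ (by fun_prop)))
    exact hT.comp (g := fun y : (List ℕ × ℕ) × ℕ => (y.1.1, y.2)) (by fun_prop)
  have hD : Computable fun x : List ℕ × ℕ => D x.1 x.2 := by
    refine computable_bool_or hF (computable_bool_and (by fun_prop)
      (computable_bool_and ?_ (by fun_prop)))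
    exact hF.comp (g := fun x : List ℕ × ℕ => (x.1, x.2 - 1)) (by fun_prop)
  have hW : Computable W := by fun_prop
  have hq : Computable q := by
    have : Computable fun e => D (W e) e.unpair.1 :=
      hD.comp (g := fun e => (W e, e.unpair.1)) (by fun_prop)
    fun_prop
  refine ⟨q, hq, fun P z hP => ?_⟩
  let t : ℕ → Bool := fun n => S₀ (pre P n, ()) || S₁ (pre P n, ())
  have hTt : ∀ m n, n ≤ m → T (pre P m) n = t n := by
    intro m n hnm
    simp only [T, t, take_pre P hnm]
  have hFt : ∀ m n, n ≤ m → (F (pre P m) n = true ↔ t n = true ∧ ∀ s < n, t s = false) := by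
    intro m n hnm
    simp only [F, Bool.and_eq_true, hTt m n hnm, Bool.not_eq_true', ← Bool.not_eq_true, anyLt_iff]
    refine and_congr_right fun _ => ?_
    push Not
    refine forall_congr' fun s => forall_congr' fun hs => ?_
    rw [hTt m s (by omega)]
  have hWq : ∀ n m, W (query P n m) = pre P m ∧ (query P n m).unpair.1 = n := by
    intro n m
    simp [W, query]
  refine ⟨fun n => bif D (pre P n) n then 1 else 0, mem_assocFun.2 fun n => ⟨n, ?_, ?_⟩, ?_⟩
  · change q (query P n n) = _
    have h1 : Nat.ble n n = true := by rw [Nat.ble_eq]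
    simp only [q, (hWq n n).1, (hWq n n).2, length_pre, h1, cond_true]
    cases D (pre P n) n <;> rfl
  · intro m hm
    have h1 : Nat.ble n m = false := by
      rw [← Bool.not_eq_true, Nat.ble_eq]
      omega
    simp only [q, (hWq n m).1, (hWq n m).2, length_pre, h1, cond_false]
  · by_cases hex : ∃ n, t n = true
    · let n₀ := Nat.find hex
      have hn₀ : t n₀ = true := Nat.find_spec hex
      have hlt : ∀ s < n₀, t s = false := fun s hs => Bool.eq_false_iff.2 (Nat.find_min hex hs)
      have hF' : ∀ m n, n ≤ m → (F (pre P m) n = true ↔ n = n₀) := by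
        intro m n hnm
        rw [hFt m n hnm]
        constructor
        · rintro ⟨h1, h2⟩
          rcases lt_trichotomy n n₀ with h | h | h
          · rw [hlt n h] at h1
            exact absurd h1 (by simp)
          · exact h
          · rw [h2 n₀ h] at hn₀
            exact absurd hn₀ (by simp)
        · rintro rfl
          exact ⟨hn₀, hlt⟩
      have hD' : ∀ n, D (pre P n) n = true ↔
          n = n₀ ∨ (n = n₀ + 1 ∧ S₁ (pre P n₀, ()) = true) := by
        intro n
        simp only [D, Bool.or_eq_true, Bool.and_eq_true, hF' n n le_rfl,
          hF' n (n - 1) (Nat.sub_le _ _), Nat.ble_eq, take_pre P (Nat.sub_le n 1)]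
        refine or_congr_right ?_
        constructor
        · rintro ⟨h1, h2, h3⟩
          rw [h2] at h3
          exact ⟨by omega, h3⟩
        · rintro ⟨rfl, h3⟩
          exact ⟨by omega, by omega, h3⟩
      -- Preferring `S₁` is harmless: its acceptance already proves that the value is 1, and without
      -- it `S₀` must have accepted.
      by_cases hS : S₁ (pre P n₀, ()) = true
      · refine Or.inr ⟨1, (H₁ P z hP).2 ((hR₁ _ _).2 ⟨n₀, hS⟩), n₀, fun n => ?_⟩
        have : D (pre P n) n = true ↔ n₀ ≤ n ∧ n < n₀ + (((1 : Fin 2) : ℕ) + 1) := by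
          rw [hD']
          rw [and_iff_left hS, Fin.val_one]
          omega
        by_cases hd : D (pre P n) n = true
        · rw [if_pos (this.1 hd)]
          simp [hd]
        · rw [if_neg (mt this.2 hd)]
          simp [hd]
      · have hS0 : S₀ (pre P n₀, ()) = true := by
          simpa [t, hS] using hn₀
        refine Or.inr ⟨0, (H₀ P z hP).2 ((hR₀ _ _).2 ⟨n₀, hS0⟩), n₀, fun n => ?_⟩
        have : D (pre P n) n = true ↔ n₀ ≤ n ∧ n < n₀ + (((0 : Fin 2) : ℕ) + 1) := by
          rw [hD']
          have : (n = n₀ ∨ n = n₀ + 1 ∧ S₁ (pre P n₀, ()) = true) ↔ n = n₀ :=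
            or_iff_left fun h => hS h.2
          rw [this, Fin.val_zero]
          omega
        by_cases hd : D (pre P n) n = true
        · rw [if_pos (this.1 hd)]
          simp [hd]
        · rw [if_neg (mt this.2 hd)]
          simp [hd]
    · push Not at hex
      refine Or.inl ⟨?_, fun n => ?_⟩
      · have hn : ∀ n, S₀ (pre P n, ()) ≠ true ∧ S₁ (pre P n, ()) ≠ true := by
          intro n
          have := hex n
          simpa [t] using this
        by_contra hb
        obtain ⟨l, hl⟩ := WithBot.ne_bot_iff_exists.1 hb
        have h01 : l = 0 ∨ l = 1 := by omega
        rcases h01 with rfl | rfl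
        · obtain ⟨m, hm⟩ := (hR₀ _ _).1 ((H₀ P z hP).1 hl.symm)
          exact (hn m).1 hm
        · obtain ⟨m, hm⟩ := (hR₁ _ _).1 ((H₁ P z hP).1 hl.symm)
          exact (hn m).2 hm
      · have hF0 : ∀ m ≤ n, F (pre P n) m = false := by
          intro m hm
          rw [Bool.eq_false_iff]
          intro h
          exact hex m ((hFt n m hm).1 h).1
        have : D (pre P n) n = false := by
          simp [D, hF0 n le_rfl, hF0 (n - 1) (Nat.sub_le _ _)]
        simp [this]

/-- Strictly far extensions are weakly far, so the two witnesses of sparseness are among the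
extensions on which denseness demands equal labels. -/
theorem not_denseAt_of_sparseAt {X : Type*} [MetricSpace X] {A : Naming X} {k : ℕ}
    {L : Learner A k} {N : ℕ} {ε : ℝ} {data : List (X × Fin k)} {x : X}
    (hs : SparseAt L N ε data x) : ¬ DenseAt L N ε data x := by
  obtain ⟨a, b, haN, hbN, ha, hb, -, hab, -⟩ := hs
  exact fun hd => hab (hd a b haN hbN (fun y hy => (ha y hy).le) fun y hy => (hb y hy).le).1

end CompAnalysis

/-! ### Definition of the map by cases, and its computability -/

theorem theorem4p5 {X : Type*} [MetricSpace X] (M : ComputableMetric X)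
    (hM : ComputablyCompact M.naming) (k : ℕ) (hk : 0 < k) :
    ∃ SprsOrDns : Learner M.naming k × ℕ × {ε : ℝ // 0 < ε} × List (X × Fin k) × X →
        WithBot (Fin 2),
      (∀ (L : Learner M.naming k) (N : ℕ) (ε : {ε : ℝ // 0 < ε}) (data : List (X × Fin k)) (x : X),
        (SprsOrDns (L, N, ε, data, x) = ((0 : Fin 2) : WithBot (Fin 2)) ↔
          SparseAt L N ε data x) ∧
        (SprsOrDns (L, N, ε, data, x) = ((1 : Fin 2) : WithBot (Fin 2)) ↔
          DenseAt L N ε data x)) ∧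
      IsComputable
        ((learnerNaming M.naming k).prod (natNaming.prod
          ((realNaming.subtype fun ε => 0 < ε).prod ((dataNaming M.naming k).prod M.naming))))
        (labelNaming 2) SprsOrDns := by
  classical
  obtain ⟨g, hgc, hg⟩ := M.dist_computable
  obtain ⟨J, hJc, hJ⟩ := exists_computable_cover hgc hg hM
  let f : Learner M.naming k × ℕ × {ε : ℝ // 0 < ε} × List (X × Fin k) × X → WithBot (Fin 2) :=
    fun z => if SparseAt z.1 z.2.1 z.2.2.1 z.2.2.2.1 z.2.2.2.2 then ((0 : Fin 2) : WithBot (Fin 2))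
      else if DenseAt z.1 z.2.1 z.2.2.1 z.2.2.2.1 z.2.2.2.2 then ((1 : Fin 2) : WithBot (Fin 2))
      else ⊥
  have hf : ∀ (L : Learner M.naming k) (N : ℕ) (ε : {ε : ℝ // 0 < ε}) (data : List (X × Fin k))
      (x : X), (f (L, N, ε, data, x) = ((0 : Fin 2) : WithBot (Fin 2)) ↔ SparseAt L N ε data x) ∧
        (f (L, N, ε, data, x) = ((1 : Fin 2) : WithBot (Fin 2)) ↔ DenseAt L N ε data x) := by
    intro L N ε data x
    have h01 : ((0 : Fin 2) : WithBot (Fin 2)) ≠ ((1 : Fin 2) : WithBot (Fin 2)) := by decide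
    by_cases hs : SparseAt L N ε data x
    · simpa [f, hs, not_denseAt_of_sparseAt hs] using h01
    · by_cases hd : DenseAt L N ε data x
      · simpa [f, hs, hd] using h01.symm
      · simp [f, hs, hd]
  refine ⟨f, hf, isComputable_of_semidec (A := inputNaming M k)
    (semidec_exists_farExtension hgc k) (semidec_forall_label hgc hJc k) ?_ ?_⟩
  · rintro P ⟨L, N, ε, data, x⟩ hP
    exact (hf L N ε data x).1.trans (sparseAt_iff hgc hg hP)
  · rintro P ⟨L, N, ε, data, x⟩ hP
    exact (hf L N ε data x).2.trans (denseAt_iff hg hM hJ hP)
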